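/- Let $A$ be a nonempty finite alphabet, and let $A^{\mathbb Z}$ carry the metric $d(x,y)=2^{-n}$, $n=\min\{i\in\mathbb N: x_i\ne y_i\text{ or }x_{-i}\ne y_{-i}\}$. Let $\sigma(x)_i=x_{i+1}$ be the shift and let $F:A^{\mathbb Z}\to A^{\mathbb Z}$ be a cellular automaton. For $a\in A$ let ${}^\infty a^\infty$ be the configuration constantly equal to $a$, and let $\mathcal O_F({}^\infty a^\infty)=\{F^t({}^\infty a^\infty):t\in\mathbb N\}$. A curve is a map $h:\mathbb N\to\mathbb Z$ with $\sup_t|h(t+1)-h(t)|<\infty$; $\mathcal B$ is the set of curves. For sequences $h,h'$ (with values in $\mathbb Z\cup\{\pm\infty\}$) write $h\preceq h'$ if $h\le h'+M$ for some constant $M\in\mathbb N$; for integer sequences write $h\prec h'$ if $h\preceq h'$ and $h'\not\preceq h$; $h\sim h'$ if $h\preceq h'$ and $h'\preceq h$; $h\ll h'$ if $h'(t)-h(t)\to+\infty$. A direction is a class of $\mathcal B$ under $\sim$. An interval with bounds $h'\preceq h''$, where $h',h'':\mathbb N\to\mathbb Z$ are arbitrary sequences, is a set $\{h\in\mathcal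 B: h'\,R\,h\,R'\,h''\}$ with $R,R'\in\{\preceq,\prec\}$; it is called nondegenerate if it contains two curves $h_1\prec h_2$. Let $\rho_-(t)$ be the supremum of the $i\in\mathbb Z$ such that $F^t(x)_0$ depends only on $(x_j)_{j\ge i}$, $\rho_+(t)$ the infimum of the $i\in\mathbb Z$ such that $F^t(x)_0$ depends only on $(x_j)_{j\le i}$, and $[-\rho_+,-\rho_-]=\{h\in\mathcal B:-\rho_+\preceq h\preceq-\rho_-\}$. For $h\in\mathcal B$ put $F_t=F^t\sigma^{h(t)}$. Along $h$: $\mathcal E_{F,h}$ is the set of equicontinuous points $x$ (for all $\varepsilon>0$ there is $\delta>0$ such that $d(x,y)<\delta$ implies $d(F_t(x),F_t(y))<\varepsilon$ for all $t$); $F$ is equicontinuous if $\mathcal E_{F,h}=A^{\mathbb Z}$, almost equicontinuous if $\mathcal E_{F,h}$ is comeager, strictly almost equicontinuous if it is almost equicontinuous but not equicontinuous, and sensitive if there is $\varepsilon>0$ such that for all $x$ and $\delta>0$ there are $y,t$ with $d(x,y)<\delta$ and $d(F_t(x),F_t(y))\ge\varepsilon$. The realm $\mathfrak D_{F,h}(V)$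 of $V$ is the set of points $x$ such that all limit points of $(F_t(x))_t$ belong to $V$; the generic limit set $\tilde\omega_{F,h}$ is the intersection of all closed sets with comeager realm; the asymptotic class $\mathfrak C_{F,h}(y)$ is the set of $x$ with $d(F_t(x),F_t(y))\to0$. Finally $\Omega_F=\bigcap_T\overline{\bigcup_{t\ge T}F^t(A^{\mathbb Z})}$ is the limit set, and $F$ is nilpotent if there are $T$ and $z$ with $F^t(x)=z$ for all $x$ and all $t\ge T$. Then $F$ satisfies exactly one of the following six statements. 1. $F$ is nilpotent, and there is $a\in A$ such that $\tilde\omega_{F,h}=\{{}^\infty a^\infty\}$ for all $h\in\mathcal B$. 2. $F$ is equicontinuous along a single direction $h'\in[-\rho_+,-\rho_-]$ and sensitive along all other directions; for every $h\in\mathcal B$, $\tilde\omega_{F,h}=\Omega_F$ is infinite. 3. There is a nondegenerate interval $S\subseteq[-\rho_+,-\rho_-]$, with bounds $s'\preceq s''$, such that $F$ is strictly almost equicontinuous along every $h\in S$ and sensitive along every $h\in\mathcal B\setminus S$; there is $a\in A$ such that for every $h\in S$, $\tilde\omega_{F,h}=\mathcal O_F({}^\infty a^\infty)$ and $$\mathcal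 E_{F,h}\subseteq\mathfrak C_{F,h}({}^\infty a^\infty)\subseteq\mathfrak D_{F,h}(\tilde\omega_{F,h})=\bigcup_{y\in\mathcal O_F({}^\infty a^\infty)}\mathfrak C_{F,h}(y);$$ $\tilde\omega_{F,h}$ is infinite for every $h\in\mathcal B\setminus S$; and $\mathcal E_{F,h}$ includes a dense open set for every $h\in\mathcal B$ with $s'\ll h\ll s''$. 4. $F$ is strictly almost equicontinuous along a single direction $h'\in[-\rho_+,-\rho_-]$ and sensitive along all other directions; $\tilde\omega_{F,h}$ is infinite for every $h\in\mathcal B$. 4'. $F$ is strictly almost equicontinuous along a single direction $h'\in[-\rho_+,-\rho_-]$ and sensitive along all other directions; for $h\in\mathcal B$, $\tilde\omega_{F,h}$ is finite if and only if $h\sim h'$. 5. For every $h\in\mathcal B$, $F$ is sensitive along $h$ and $\tilde\omega_{F,h}$ is infinite. -/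

import Mathlib

open Filter Topology Set

namespace GenericLimit

/-! ### Nonuniform dynamical systems: sequences of self-maps of a metric space -/

section DynamicalSystems

variable {X : Type*} [MetricSpace X]

/-- The point `x` is `ε`-stable for the sequence of maps `Φ`. -/
def IsStable (Φ : ℕ → X → X) (ε : ℝ) (x : X) : Prop :=
  ∃ δ > 0, ∀ y, dist x y < δ → ∀ t, dist (Φ t x) (Φ t y) < ε

/-- The set of equicontinuous points. -/
def equicontinuousPoints (Φ : ℕ → X → X) : Set X :=
  {x | ∀ ε > 0, IsStable Φ ε x}

/-- Almost equicontinuity: the equicontinuous points form a comeager set. -/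
def AlmostEquicontinuous (Φ : ℕ → X → X) : Prop :=
  equicontinuousPoints Φ ∈ residual X

/-- Equicontinuity: every point is an equicontinuous point. -/
def IsEquicontinuous (Φ : ℕ → X → X) : Prop :=
  equicontinuousPoints Φ = univ

/-- Strict almost equicontinuity: almost equicontinuous but not equicontinuous. -/
def StrictlyAlmostEquicontinuous (Φ : ℕ → X → X) : Prop :=
  AlmostEquicontinuous Φ ∧ ¬ IsEquicontinuous Φ

/-- Sensitivity to initial conditions. -/
def Sensitive (Φ : ℕ → X → X) : Prop :=
  ∃ ε > 0, ∀ x, ∀ δ > 0, ∃ y, dist x y < δ ∧ ∃ t, ε ≤ dist (Φ t x) (Φ t y)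

/-- Nilpotence: all orbits are ultimately equal to one and the same point, uniformly. -/
def Nilpotent (Φ : ℕ → X → X) : Prop :=
  ∃ z, ∃ T, ∀ x, ∀ t ≥ T, Φ t x = z

/-- The limit set `⋂ T, closure (⋃ t ≥ T, Φ t X)`. -/
def limitSet (Φ : ℕ → X → X) : Set X :=
  omegaLimit atTop Φ univ

/-- The realm of attraction of `V`: the points all of whose orbit's limit points lie in `V`. -/
def realm (Φ : ℕ → X → X) (V : Set X) : Set X :=
  {x | omegaLimit atTop Φ {x} ⊆ V}

/-- The generic limit set: the intersection of all closed sets with a comeager realm. -/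
def genericLimitSet (Φ : ℕ → X → X) : Set X :=
  ⋂₀ {V | IsClosed V ∧ realm Φ V ∈ residual X}

/-- The asymptotic class of `y`. -/
def asymptoticClass (Φ : ℕ → X → X) (y : X) : Set X :=
  {x | Tendsto (fun t => dist (Φ t x) (Φ t y)) atTop (𝓝 0)}

/-- The orbit of `x` under the sequence `Φ`. -/
def orbit (Φ : ℕ → X → X) (x : X) : Set X :=
  range (fun t => Φ t x)

end DynamicalSystems

/-! ### The space of configurations -/

/-- Bi-infinite configurations over the alphabet `A`. -/
def Config (A : Type*) : Type _ := ℤ → A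

section Configurations

variable {A : Type*}

/-- The first `i : ℕ` at which `x` and `y` differ in position `i` or `-i`. -/
noncomputable def firstDiff (x y : Config A) : ℕ :=
  sInf {i : ℕ | x i ≠ y i ∨ x (-i) ≠ y (-i)}

open Classical in
/-- The distance `2 ^ (-n)` where `n` is the first index of disagreement. -/
noncomputable def configDist (x y : Config A) : ℝ :=
  if x = y then 0 else (2 : ℝ)⁻¹ ^ firstDiff x y

theorem firstDiff_mem {x y : Config A} (h : x ≠ y) :
    x (firstDiff x y) ≠ y (firstDiff x y) ∨ x (-(firstDiff x y : ℤ)) ≠ y (-(firstDiff x y : ℤ)) := by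
  have hne : {i : ℕ | x i ≠ y i ∨ x (-i) ≠ y (-i)}.Nonempty := by
    by_contra hemp
    rw [Set.not_nonempty_iff_eq_empty] at hemp
    apply h
    funext j
    have hj : j.natAbs ∉ {i : ℕ | x i ≠ y i ∨ x (-i) ≠ y (-i)} := by rw [hemp]; simp
    simp only [Set.mem_ofPred_eq, not_or, not_not] at hj
    rcases Int.natAbs_eq j with h' | h'
    · rw [h']; exact hj.1
    · rw [h']; exact hj.2
  exact Nat.sInf_mem hne

theorem configDist_of_ne {x y : Config A} (h : x ≠ y) :
    configDist x y = (2 : ℝ)⁻¹ ^ firstDiff x y := if_neg h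

theorem configDist_nonneg (x y : Config A) : 0 ≤ configDist x y := by
  unfold configDist; split_ifs <;> positivity

theorem configDist_triangle (x y z : Config A) :
    configDist x z ≤ configDist x y + configDist y z := by
  by_cases hxz : x = z
  · have h1 := configDist_nonneg x y
    have h2 := configDist_nonneg y z
    have h3 : configDist x z = 0 := if_pos hxz
    linarith
  · rw [configDist_of_ne hxz]
    have key : ∀ u v : Config A, (u (firstDiff x z) ≠ v (firstDiff x z) ∨
        u (-(firstDiff x z : ℤ)) ≠ v (-(firstDiff x z : ℤ))) →
        (2 : ℝ)⁻¹ ^ firstDiff x z ≤ configDist u v := by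
      intro u v huv
      have hne : u ≠ v := by rintro rfl; simp at huv
      rw [configDist_of_ne hne]
      exact pow_le_pow_of_le_one (by norm_num) (by norm_num) (Nat.sInf_le huv)
    have hor : (x (firstDiff x z) ≠ y (firstDiff x z) ∨
        x (-(firstDiff x z : ℤ)) ≠ y (-(firstDiff x z : ℤ))) ∨
        (y (firstDiff x z) ≠ z (firstDiff x z) ∨
        y (-(firstDiff x z : ℤ)) ≠ z (-(firstDiff x z : ℤ))) := by
      by_contra hcon
      simp only [not_or, not_not] at hcon
      rcases firstDiff_mem hxz with h | h
      · exact h (hcon.1.1.trans hcon.2.1)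
      · exact h (hcon.1.2.trans hcon.2.2)
    rcases hor with h | h
    · have := key x y h
      have := configDist_nonneg y z
      linarith
    · have := key y z h
      have := configDist_nonneg x y
      linarith

noncomputable instance : MetricSpace (Config A) where
  dist := configDist
  dist_self x := if_pos rfl
  dist_comm x y := by
    by_cases h : x = y
    · rw [h]
    · rw [configDist_of_ne h, configDist_of_ne (Ne.symm h)]
      unfold firstDiff
      simp only [ne_comm]
  dist_triangle := configDist_triangle
  eq_of_dist_eq_zero {x y} h := by
    by_contra hne
    have h' : configDist x y = 0 := h
    rw [configDist_of_ne hne] at h'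
    have : (0 : ℝ) < (2 : ℝ)⁻¹ ^ firstDiff x y := by positivity
    linarith

/-- The monochrome configuration with the single symbol `a`. -/
def mono (a : A) : Config A := fun _ => a

/-- The `k`-th power (`k : ℤ`) of the shift `σ`, where `σ x i = x (i + 1)`. -/
def shiftPow (k : ℤ) (x : Config A) : Config A := fun i => x (i + k)

/-! ### Cellular automata and directions -/

/-- `F` is a cellular automaton: it is given by a local rule `f` on a window `[m, p]`. -/
def IsCA (F : Config A → Config A) : Prop :=
  ∃ m p : ℤ, m ≤ p ∧ ∃ f : (Set.Icc m p → A) → A,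
    ∀ (x : Config A) (i : ℤ), F x i = f (fun j => x (i + j))

/-- The sequence of the iterates of `F`. -/
def iterates (F : Config A → Config A) (t : ℕ) : Config A → Config A := F^[t]

/-- `F` in direction `h`: the sequence `F ^ t ∘ σ ^ h(t)`. -/
def along (F : Config A → Config A) (h : ℕ → ℤ) (t : ℕ) : Config A → Config A :=
  fun x => F^[t] (shiftPow (h t) x)

/-- The minimal memory of `G`, in `[-∞, +∞]` (it is `+∞` when `G` is constant). -/
noncomputable def memory (G : Config A → Config A) : EReal :=
  sSup {r | ∃ i : ℤ, r = ((i : ℝ) : EReal) ∧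
    ∀ x y : Config A, (∀ j, i ≤ j → x j = y j) → G x 0 = G y 0}

/-- The minimal anticipation of `G`, in `[-∞, +∞]` (it is `-∞` when `G` is constant). -/
noncomputable def anticipation (G : Config A → Config A) : EReal :=
  sInf {r | ∃ i : ℤ, r = ((i : ℝ) : EReal) ∧
    ∀ x y : Config A, (∀ j, j ≤ i → x j = y j) → G x 0 = G y 0}

end Configurations

/-- Curves: the sequences of integers with bounded variation. -/
def curves : Set (ℕ → ℤ) := {h | ∃ M : ℤ, ∀ t, |h (t + 1) - h t| ≤ M}

/-- `h ≼ h'`: `h ≤ h' + M` for some constant `M`. -/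
def Preceq {R : Type*} [LE R] [Add R] [NatCast R] (h h' : ℕ → R) : Prop :=
  ∃ M : ℕ, ∀ t, h t ≤ h' t + M

/-- `h ≺ h'`: `h ≼ h'` but not `h' ≼ h`. -/
def Prec (h h' : ℕ → ℤ) : Prop := Preceq h h' ∧ ¬ Preceq h' h

/-- Equivalence of curves: `h` and `h'` define the same direction. -/
def SameDir (h h' : ℕ → ℤ) : Prop := Preceq h h' ∧ Preceq h' h

/-- `h ≪ h'`: the difference `h' - h` tends to infinity. -/
def Pprec (h h' : ℕ → ℤ) : Prop := Tendsto (fun t => h' t - h t) atTop atTop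

/-- `S` is an interval of curves with bounds `lo` and `hi`, of one of the four kinds
`[lo, hi]`, `[lo, hi[`, `]lo, hi]`, `]lo, hi[`. The bounds themselves are arbitrary sequences of
integers, not necessarily of bounded variation. -/
def IsCurveInterval (S : Set (ℕ → ℤ)) (lo hi : ℕ → ℤ) : Prop :=
  Preceq lo hi ∧
    (S = {h ∈ curves | Preceq lo h ∧ Preceq h hi} ∨
     S = {h ∈ curves | Preceq lo h ∧ Prec h hi} ∨
     S = {h ∈ curves | Prec lo h ∧ Preceq h hi} ∨
     S = {h ∈ curves | Prec lo h ∧ Prec h hi})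

section Classes

variable {A : Type*}

/-- The curves of the interval `[-ρ₊, -ρ₋]`, where `ρ₋(t)` and `ρ₊(t)` are the minimal memory and
anticipation of `F ^ t`. -/
def nonObliqueCurves (F : Config A → Config A) : Set (ℕ → ℤ) :=
  {h ∈ curves | Preceq (fun t => - anticipation (iterates F t)) (fun t => ((h t : ℝ) : EReal)) ∧
    Preceq (fun t => ((h t : ℝ) : EReal)) (fun t => - memory (iterates F t))}

/-- Class 1: nilpotent. -/
def Class1 (F : Config A → Config A) : Prop :=
  Nilpotent (iterates F) ∧
    ∃ a : A, ∀ h ∈ curves, genericLimitSet (along F h) = {mono a}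

/-- Class 2: equicontinuous along a single direction, sensitive along the others. -/
def Class2 (F : Config A → Config A) : Prop :=
  (∃ h' ∈ nonObliqueCurves F, ∀ h ∈ curves,
    (SameDir h h' → IsEquicontinuous (along F h)) ∧
    (¬ SameDir h h' → Sensitive (along F h))) ∧
  (∀ h ∈ curves, genericLimitSet (along F h) = limitSet (iterates F)) ∧
  (limitSet (iterates F)).Infinite

/-- Class 3: strictly almost equicontinuous along a nondegenerate interval of directions,
sensitive along the others. -/
def Class3 (F : Config A → Config A) : Prop :=
  ∃ (S : Set (ℕ → ℤ)) (lo hi : ℕ → ℤ),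
    IsCurveInterval S lo hi ∧ (∃ h₁ ∈ S, ∃ h₂ ∈ S, Prec h₁ h₂) ∧
    S ⊆ nonObliqueCurves F ∧
    (∀ h ∈ S, StrictlyAlmostEquicontinuous (along F h)) ∧
    (∀ h ∈ curves, h ∉ S → Sensitive (along F h)) ∧
    (∃ a : A,
      (∀ h ∈ S, genericLimitSet (along F h) = orbit (iterates F) (mono a)) ∧
      (∀ h ∈ S, equicontinuousPoints (along F h) ⊆ asymptoticClass (along F h) (mono a) ∧
        asymptoticClass (along F h) (mono a) ⊆ realm (along F h) (genericLimitSet (along F h)) ∧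
        realm (along F h) (genericLimitSet (along F h)) =
          ⋃ y ∈ orbit (iterates F) (mono a), asymptoticClass (along F h) y)) ∧
    (∀ h ∈ curves, h ∉ S → (genericLimitSet (along F h)).Infinite) ∧
    (∀ h ∈ curves, Pprec lo h → Pprec h hi →
      ∃ U : Set (Config A), IsOpen U ∧ Dense U ∧ U ⊆ equicontinuousPoints (along F h))

/-- Strict almost equicontinuity along the single direction of `h'`, sensitivity along the others. -/
def SingleStrictDirection (F : Config A → Config A) (h' : ℕ → ℤ) : Prop :=
  ∀ h ∈ curves,
    (SameDir h h' → StrictlyAlmostEquicontinuous (along F h)) ∧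
    (¬ SameDir h h' → Sensitive (along F h))

/-- Class 4: strictly almost equicontinuous along a single direction, all generic limit sets
infinite. -/
def Class4 (F : Config A → Config A) : Prop :=
  (∃ h' ∈ nonObliqueCurves F, SingleStrictDirection F h') ∧
  ∀ h ∈ curves, (genericLimitSet (along F h)).Infinite

/-- Class 4': strictly almost equicontinuous along a single direction, the generic limit set being
finite exactly along this direction. -/
def Class4' (F : Config A → Config A) : Prop :=
  ∃ h' ∈ nonObliqueCurves F, SingleStrictDirection F h' ∧
    ∀ h ∈ curves, (genericLimitSet (along F h)).Finite ↔ SameDir h h'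

/-- Class 5: sensitive in every direction. -/
def Class5 (F : Config A → Config A) : Prop :=
  ∀ h ∈ curves, Sensitive (along F h) ∧ (genericLimitSet (along F h)).Infinite

end Classes

end GenericLimit

/-!
The whole classification follows from the study of *blocking words*. A word forces a cell of the
space-time diagram if the content of this cell is the same for all configurations carrying the
word; it is blocking along a curve `h` if it forces, at every time, a window around `h t` wide
enough for no information to jump over it in one step.

* `F` is not sensitive along `h` iff there is a blocking word along `h`, iff `F` is almost
  equicontinuous along `h`, because everything between two occurrences of a blocking word is forced
  (`IsBlock.forced_between`, `IsBlock.almostEquicontinuous`).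
* If the generic limit set along `h` is finite, Baire's theorem gives a cylinder whose trajectories
  stay near this finite set, and are then driven by finitely many central windows: this yields a
  blocking word (`HasRadius.exists_blocking_of_finite`). So sensitivity along `h` implies that the
  generic limit set is infinite.
* Suppose that `F` is not nilpotent, and let `u` be blocking along `h`. If `u'` is blocking along
  another curve `h'`, place `u'` beside `u`: what it forces on the other side of `u` cannot depend
  on its presence, so that `u` alone already forces it (`IsBlock.forced_of_forced_right`). Hence the
  curves of almost equicontinuity are exactly those between the two ends of the interval forced by
  this single word `u`, up to additive constants (`IsBlock.almostEquicontinuous_iff`). In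
  particular they form an interval which is closed.
* If this interval contains two directions, the intervals forced by `u` get arbitrarily wide;
  overlapping those of two copies of `u` shows that they are monochrome
  (`IsBlock.eq_of_mem_ends`), so that all equicontinuous points are attracted by one periodic orbit
  of monochrome configurations (`IsBlock.exists_asymptotic_mono`). This is class 3; were `F`
  equicontinuous, compactness would make it nilpotent.
* If it contains only one direction and `F` is equicontinuous along it, only finitely many local
  rules occur along it, so that `F` is ultimately periodic up to a shift
  (`HasRadius.exists_period`), and generic trajectories along any curve accumulate on the whole
  limit set (`HasRadius.range_subset_genericLimitSet`). This is class 2; otherwise the class is 4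
  or 4', according to the finiteness of the generic limit set.
-/

namespace GenericLimit

/-! ### Cylinders and the topology of the space of configurations -/

variable {A : Type*}

/-- `x` and `y` agree on the window `[-n, n]`; the sets `{y | Agree n x y}` are the cylinders. -/
def Agree (n : ℕ) (x y : Config A) : Prop := ∀ j : ℤ, -n ≤ j → j ≤ n → x j = y j

theorem Agree.refl (n : ℕ) (x : Config A) : Agree n x x := fun _ _ _ => rfl

theorem Agree.symm {n : ℕ} {x y : Config A} (h : Agree n x y) : Agree n y x :=
  fun j h1 h2 => (h j h1 h2).symm

theorem Agree.trans {n : ℕ} {x y z : Config A} (h : Agree n x y) (h' : Agree n y z) :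
    Agree n x z :=
  fun j h1 h2 => (h j h1 h2).trans (h' j h1 h2)

theorem Agree.mono {n m : ℕ} (hnm : n ≤ m) {x y : Config A} (h : Agree m x y) : Agree n x y :=
  fun j h1 h2 => h j (by omega) (by omega)

theorem dist_lt_pow_iff (x y : Config A) (n : ℕ) : dist x y < (2 : ℝ)⁻¹ ^ n ↔ Agree n x y := by
  by_cases hxy : x = y
  · subst hxy
    simp only [dist_self]
    exact ⟨fun _ => Agree.refl n x, fun _ => by positivity⟩
  have hd : dist x y = (2 : ℝ)⁻¹ ^ firstDiff x y := configDist_of_ne hxy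
  rw [hd, pow_lt_pow_iff_right_of_lt_one₀ (by norm_num) (by norm_num)]
  constructor
  · intro h j h1 h2
    have hj : j.natAbs ∉ {i : ℕ | x i ≠ y i ∨ x (-i) ≠ y (-i)} :=
      Nat.notMem_of_lt_sInf (show j.natAbs < firstDiff x y by omega)
    simp only [Set.mem_ofPred_eq, not_or, not_not] at hj
    rcases Int.natAbs_eq j with h' | h'
    · rw [h']; exact hj.1
    · rw [h']; exact hj.2
  · intro h
    by_contra hlt
    rcases firstDiff_mem hxy with h' | h'
    · exact h' (h _ (by omega) (by omega))
    · exact h' (h _ (by omega) (by omega))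

theorem exists_pow_lt {ε : ℝ} (hε : 0 < ε) : ∃ n : ℕ, (2 : ℝ)⁻¹ ^ n < ε :=
  exists_pow_lt_of_lt_one hε (by norm_num)

theorem mem_nhds_iff_agree {x : Config A} {s : Set (Config A)} :
    s ∈ 𝓝 x ↔ ∃ n : ℕ, {y | Agree n x y} ⊆ s := by
  rw [Metric.mem_nhds_iff]
  constructor
  · rintro ⟨ε, hε, h⟩
    obtain ⟨n, hn⟩ := exists_pow_lt hε
    refine ⟨n, fun y hy => h ?_⟩
    rw [Metric.mem_ball, dist_comm]
    exact ((dist_lt_pow_iff x y n).2 hy).trans hn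
  · rintro ⟨n, h⟩
    refine ⟨(2 : ℝ)⁻¹ ^ n, by positivity, fun y hy => h ?_⟩
    rw [Metric.mem_ball, dist_comm] at hy
    exact (dist_lt_pow_iff x y n).1 hy

theorem isOpen_iff_agree {s : Set (Config A)} :
    IsOpen s ↔ ∀ x ∈ s, ∃ n : ℕ, {y | Agree n x y} ⊆ s := by
  simp only [isOpen_iff_mem_nhds, mem_nhds_iff_agree]

theorem isOpen_agree (x : Config A) (n : ℕ) : IsOpen {y | Agree n x y} :=
  isOpen_iff_agree.2 fun _ hy => ⟨n, fun _ hz => Agree.trans hy hz⟩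

theorem isClosed_agree (x : Config A) (n : ℕ) : IsClosed {y | Agree n x y} := by
  rw [← isOpen_compl_iff, isOpen_iff_agree]
  exact fun y hy => ⟨n, fun z hz hxz => hy (Agree.trans hxz (Agree.symm hz))⟩

instance [Finite A] : CompactSpace (Config A) := by
  let _ : TopologicalSpace A := ⊥
  have : DiscreteTopology A := ⟨rfl⟩
  let e : (ℤ → A) → Config A := fun x => x
  have he : Continuous e := by
    rw [continuous_iff_continuousAt]
    intro x s hs
    obtain ⟨n, hn⟩ := mem_nhds_iff_agree.1 hs
    have hopen : IsOpen (Set.pi (Set.Icc (-n : ℤ) n) (fun j => ({x j} : Set A))) :=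
      isOpen_set_pi (Set.finite_Icc _ _) (fun _ _ => isOpen_discrete _)
    refine Filter.mem_of_superset (hopen.mem_nhds (fun j _ => rfl)) ?_
    intro y hy
    exact hn fun j h1 h2 => (hy j ⟨h1, h2⟩).symm
  have := isCompact_range he
  rw [show Set.range e = Set.univ from Set.range_eq_univ.2 fun x => ⟨x, rfl⟩] at this
  exact ⟨this⟩

instance [Nonempty A] : Nonempty (Config A) := ⟨mono (Classical.arbitrary A)⟩

/-- A property of the configurations which holds on a cylinder around each point, with a bound
depending on the cylinder, holds with a uniform bound. -/
theorem exists_uniform_bound [Finite A] {Q : Config A → ℕ → Prop}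
    (hmono : ∀ y m m', m ≤ m' → Q y m → Q y m')
    (h : ∀ x, ∃ n m : ℕ, ∀ y, Agree n x y → Q y m) : ∃ m, ∀ y, Q y m := by
  choose n m hQ using h
  obtain ⟨s, -, hs⟩ := (isCompact_univ (X := Config A)).elim_nhds_subcover
    (fun x => {y | Agree (n x) x y})
    (fun x _ => (isOpen_agree x (n x)).mem_nhds (Agree.refl _ x))
  refine ⟨s.sup m, fun y => ?_⟩
  obtain ⟨x, hx, hxy⟩ := Set.mem_iUnion₂.1 (hs (Set.mem_univ y))
  exact hmono y _ _ (Finset.le_sup hx) (hQ x y hxy)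

/-! ### Cellular automata as local maps commuting with the shift -/

@[simp] theorem shiftPow_apply (k : ℤ) (x : Config A) (i : ℤ) : shiftPow k x i = x (i + k) := rfl

@[simp] theorem mono_apply (a : A) (i : ℤ) : mono a i = a := rfl

@[simp] theorem shiftPow_mono (k : ℤ) (a : A) : shiftPow k (mono a) = mono a := rfl

theorem shiftPow_shiftPow (k l : ℤ) (x : Config A) :
    shiftPow k (shiftPow l x) = shiftPow (k + l) x := by
  funext i
  simp [add_assoc]

@[simp] theorem shiftPow_zero (x : Config A) : shiftPow 0 x = x := by
  funext i
  simp

/-- `F` commutes with the shift, and `F x i` depends only on the restriction of `x` to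
`[i - r, i + r]`. -/
structure HasRadius (F : Config A → Config A) (r : ℕ) : Prop where
  congr : ∀ (x y : Config A) (i : ℤ), (∀ j, i - r ≤ j → j ≤ i + r → x j = y j) → F x i = F y i
  shift : ∀ (k : ℤ) (x : Config A), F (shiftPow k x) = shiftPow k (F x)

theorem IsCA.exists_hasRadius {F : Config A → Config A} (hF : IsCA F) : ∃ r, HasRadius F r := by
  obtain ⟨m, p, -, f, hf⟩ := hF
  refine ⟨m.natAbs + p.natAbs, fun x y i h => ?_, fun k x => ?_⟩
  · rw [hf, hf]
    congr 1
    funext ⟨j, hj⟩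
    have := hj.1
    have := hj.2
    exact h _ (by dsimp only; omega) (by dsimp only; omega)
  · funext i
    rw [shiftPow_apply, hf, hf]
    congr 1
    funext j
    rw [shiftPow_apply]
    congr 1
    ring

namespace HasRadius

variable {F : Config A → Config A} {r : ℕ}

theorem iterate (hF : HasRadius F r) (t : ℕ) : HasRadius F^[t] (r * t) := by
  induction t with
  | zero => exact ⟨fun x y i h => h i (by simp) (by simp), fun k x => rfl⟩
  | succ t ih =>
    refine ⟨fun x y i h => ?_, fun k x => ?_⟩
    · rw [Function.iterate_succ_apply', Function.iterate_succ_apply']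
      refine hF.congr _ _ _ fun j h1 h2 => ih.congr _ _ _ fun l h3 h4 => h l ?_ ?_
      · push_cast at *; linarith
      · push_cast at *; linarith
    · rw [Function.iterate_succ_apply', Function.iterate_succ_apply', ih.shift, hF.shift]

theorem agree_iterate (hF : HasRadius F r) (t n m : ℕ) (hm : n + r * t ≤ m) {x y : Config A}
    (h : Agree m x y) : Agree n (F^[t] x) (F^[t] y) := by
  intro j h1 h2
  refine (hF.iterate t).congr _ _ _ fun l h3 h4 => h l ?_ ?_ <;> omega

theorem continuous_iterate (hF : HasRadius F r) (t : ℕ) : Continuous F^[t] := by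
  rw [continuous_iff_continuousAt]
  intro x s hs
  obtain ⟨n, hn⟩ := mem_nhds_iff_agree.1 hs
  exact mem_nhds_iff_agree.2 ⟨n + r * t, fun y hy => hn (hF.agree_iterate t n _ le_rfl hy)⟩

end HasRadius

theorem continuous_shiftPow (k : ℤ) : Continuous (shiftPow k : Config A → Config A) := by
  rw [continuous_iff_continuousAt]
  intro x s hs
  obtain ⟨n, hn⟩ := mem_nhds_iff_agree.1 hs
  refine mem_nhds_iff_agree.2 ⟨n + k.natAbs, fun y hy => hn fun j h1 h2 => ?_⟩
  exact hy _ (by omega) (by omega)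

theorem HasRadius.continuous_along {F : Config A → Config A} {r : ℕ} (hF : HasRadius F r)
    (h : ℕ → ℤ) (t : ℕ) : Continuous (along F h t) :=
  (hF.continuous_iterate t).comp (continuous_shiftPow (h t))

theorem HasRadius.along_apply {F : Config A → Config A} {r : ℕ} (hF : HasRadius F r)
    (h : ℕ → ℤ) (t : ℕ) (x : Config A) (i : ℤ) : along F h t x i = F^[t] x (i + h t) := by
  rw [along, (hF.iterate t).shift, shiftPow_apply]

/-- The local rule of `F` applied to a constant window: the action of `F` on monochrome
configurations, read on letters. -/
def letterMap (F : Config A → Config A) (a : A) : A := F (mono a) 0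

theorem HasRadius.iterate_mono {F : Config A → Config A} {r : ℕ} (hF : HasRadius F r)
    (t : ℕ) (a : A) : F^[t] (mono a) = mono ((letterMap F)^[t] a) := by
  induction t with
  | zero => rfl
  | succ t ih =>
    rw [Function.iterate_succ_apply', Function.iterate_succ_apply', ih]
    funext i
    have := congrFun (hF.shift i (mono ((letterMap F)^[t] a))) 0
    rw [shiftPow_mono, shiftPow_apply, zero_add] at this
    exact this.symm

theorem HasRadius.along_mono {F : Config A → Config A} {r : ℕ} (hF : HasRadius F r)
    (h : ℕ → ℤ) (t : ℕ) (a : A) : along F h t (mono a) = mono ((letterMap F)^[t] a) := by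
  rw [along, shiftPow_mono, hF.iterate_mono]

/-- If some `F^t` is constant then `F` is nilpotent. -/
theorem HasRadius.nilpotent_of_const {F : Config A → Config A} {r : ℕ} (hF : HasRadius F r)
    (t : ℕ) (i : ℤ) (a : A) (h : ∀ x, F^[t] x i = a) : Nilpotent (iterates F) := by
  have key : ∀ x, F^[t] x = mono a := by
    intro x
    funext j
    have := h (shiftPow (j - i) x)
    rw [(hF.iterate t).shift, shiftPow_apply] at this
    simpa using this
  refine ⟨mono a, t, fun x s hs => ?_⟩
  obtain ⟨d, rfl⟩ := Nat.exists_eq_add_of_le hs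
  rw [iterates, Function.iterate_add_apply]
  exact key _

end GenericLimit

namespace GenericLimit

/-! ### Forced cells and blocking words -/

variable {A : Type*}

/-- The cell `i` at time `t` is forced by the word `u` on `[-n, n]`: `F^t x i` is the same for all
`x` which carry this word. A word is encoded here as the restriction to `[-n, n]` of a
configuration `u`. -/
def Forced (F : Config A → Config A) (u : Config A) (n t : ℕ) (i : ℤ) : Prop :=
  ∀ x, Agree n u x → F^[t] x i = F^[t] u i

/-- The word `u` on `[-n, n]` is blocking along `h`, with margin `k`: it forces, at each time `t`,
the window of radius `k` around `h t`. -/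
def Blocking (F : Config A → Config A) (h : ℕ → ℤ) (k : ℕ) (u : Config A) (n : ℕ) : Prop :=
  ∀ t i, h t - k ≤ i → i ≤ h t + k → Forced F u n t i

/-- The word of `u` on `[-n, n]` occurs in `v` around the position `q`. -/
def Occurs (u : Config A) (n : ℕ) (v : Config A) (q : ℤ) : Prop := Agree n u (shiftPow q v)

variable {F : Config A → Config A} {r : ℕ} {h : ℕ → ℤ}

theorem Forced.mono {u : Config A} {n m t : ℕ} {i : ℤ} (hnm : n ≤ m) (hu : Forced F u n t i) :
    Forced F u m t i :=
  fun x hx => hu x (hx.mono hnm)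

theorem Forced.congr {u v : Config A} {n t : ℕ} {i : ℤ} (huv : Agree n u v)
    (hu : Forced F u n t i) : Forced F v n t i :=
  fun x hx => (hu x (huv.trans hx)).trans (hu v huv).symm

theorem Blocking.mono {u : Config A} {n m k l : ℕ} (hnm : n ≤ m) (hlk : l ≤ k)
    (hu : Blocking F h k u n) : Blocking F h l u m :=
  fun t i h1 h2 => (hu t i (by omega) (by omega)).mono hnm

theorem Blocking.congr {u v : Config A} {n k : ℕ} (huv : Agree n u v)
    (hu : Blocking F h k u n) : Blocking F h k v n :=
  fun t i h1 h2 => (hu t i h1 h2).congr huv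

theorem Occurs.apply_eq (hF : HasRadius F r) {u v : Config A} {n t : ℕ} {i q : ℤ}
    (ho : Occurs u n v q) (hu : Forced F u n t i) : F^[t] v (i + q) = F^[t] u i := by
  rw [← hu _ ho, (hF.iterate t).shift, shiftPow_apply]

theorem Occurs.of_agree {u v x : Config A} {n N : ℕ} {q : ℤ} (ho : Occurs u n v q)
    (hN : n + q.natAbs ≤ N) (hx : Agree N v x) : Occurs u n x q :=
  ho.trans fun j h1 h2 => hx _ (by omega) (by omega)

theorem Occurs.forced (hF : HasRadius F r) {u v : Config A} {n t N : ℕ} {i q : ℤ}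
    (ho : Occurs u n v q) (hu : Forced F u n t i) (hN : n + q.natAbs ≤ N) :
    Forced F v N t (i + q) := fun x hx => by
  rw [ho.apply_eq hF hu, (ho.of_agree hN hx).apply_eq hF hu]

/-- Propagation of agreement inside a space-time region `D`: it suffices to know agreement at the
initial time, and at those later cells of `D` whose neighbourhood is not contained in `D`. -/
theorem HasRadius.eq_of_region (hF : HasRadius F r) {x y : Config A} (D : ℕ → ℤ → Prop)
    (h0 : ∀ i, D 0 i → x i = y i)
    (hs : ∀ t i, D (t + 1) i → F^[t + 1] x i = F^[t + 1] y i ∨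
      ∀ j, i - r ≤ j → j ≤ i + r → D t j) :
    ∀ t i, D t i → F^[t] x i = F^[t] y i := by
  intro t
  induction t with
  | zero => exact h0
  | succ t ih =>
    intro i hi
    rcases hs t i hi with h | h
    · exact h
    · rw [Function.iterate_succ_apply', Function.iterate_succ_apply']
      exact hF.congr _ _ _ fun j h1 h2 => ih j (h j h1 h2)

/-- During finitely many steps, all cells near `h` are forced by wide enough windows. -/
theorem HasRadius.exists_forced_lt (hF : HasRadius F r) (h : ℕ → ℤ) (k T : ℕ) :
    ∃ N : ℕ, ∀ (x : Config A), ∀ t < T, ∀ i, h t - k ≤ i → i ≤ h t + k → Forced F x N t i := by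
  refine ⟨∑ t ∈ Finset.range T, (r * t + (h t).natAbs + k), fun x t ht i h1 h2 y hy => ?_⟩
  have hle : r * t + (h t).natAbs + k ≤ ∑ t ∈ Finset.range T, (r * t + (h t).natAbs + k) :=
    Finset.single_le_sum (f := fun t => r * t + (h t).natAbs + k)
      (fun _ _ => Nat.zero_le _) (Finset.mem_range.2 ht)
  generalize ∑ t ∈ Finset.range T, (r * t + (h t).natAbs + k) = N at *
  exact (hF.iterate t).congr _ _ _ fun j h3 h4 => (hy j (by omega) (by omega)).symm

/-! ### Stability in terms of blocking words -/

theorem HasRadius.agree_along_iff (hF : HasRadius F r) (h : ℕ → ℤ) (k t : ℕ) (x y : Config A) :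
    Agree k (along F h t x) (along F h t y) ↔
      ∀ i, h t - k ≤ i → i ≤ h t + k → F^[t] x i = F^[t] y i := by
  constructor
  · intro hxy i h1 h2
    have := hxy (i - h t) (by omega) (by omega)
    rw [hF.along_apply, hF.along_apply] at this
    simpa using this
  · intro hxy j h1 h2
    rw [hF.along_apply, hF.along_apply]
    exact hxy _ (by omega) (by omega)

theorem HasRadius.isStable_pow_iff (hF : HasRadius F r) (h : ℕ → ℤ) (k : ℕ) (x : Config A) :
    IsStable (along F h) ((2 : ℝ)⁻¹ ^ k) x ↔ ∃ n, Blocking F h k x n := by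
  constructor
  · rintro ⟨δ, hδ, hst⟩
    obtain ⟨n, hn⟩ := exists_pow_lt hδ
    refine ⟨n, fun t i h1 h2 y hy => ?_⟩
    have := hst y (((dist_lt_pow_iff x y n).2 hy).trans hn) t
    rw [dist_lt_pow_iff, hF.agree_along_iff] at this
    exact (this i h1 h2).symm
  · rintro ⟨n, hn⟩
    refine ⟨(2 : ℝ)⁻¹ ^ n, by positivity, fun y hy t => ?_⟩
    rw [dist_lt_pow_iff, hF.agree_along_iff]
    exact fun i h1 h2 => (hn t i h1 h2 y ((dist_lt_pow_iff x y n).1 hy)).symm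

theorem HasRadius.mem_equicontinuousPoints_iff (hF : HasRadius F r) (h : ℕ → ℤ) (x : Config A) :
    x ∈ equicontinuousPoints (along F h) ↔ ∀ k, ∃ n, Blocking F h k x n := by
  constructor
  · exact fun hx k => (hF.isStable_pow_iff h k x).1 (hx _ (by positivity))
  · intro hx ε hε
    obtain ⟨k, hk⟩ := exists_pow_lt hε
    obtain ⟨δ, hδ, hst⟩ := (hF.isStable_pow_iff h k x).2 (hx k)
    exact ⟨δ, hδ, fun y hy t => (hst y hy t).trans hk⟩

theorem HasRadius.exists_blocking_of_not_sensitive (hF : HasRadius F r) {h : ℕ → ℤ}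
    (hs : ¬ Sensitive (along F h)) (k : ℕ) : ∃ u n, Blocking F h k u n := by
  simp only [Sensitive, not_exists, not_and, not_forall, not_le] at hs
  obtain ⟨x, δ, hδ, hx⟩ := hs ((2 : ℝ)⁻¹ ^ k) (by positivity)
  exact ⟨x, (hF.isStable_pow_iff h k x).1 ⟨δ, hδ, fun y hy t => hx y hy t⟩⟩

theorem not_sensitive_of_mem_equicontinuousPoints {X : Type*} [MetricSpace X] {Φ : ℕ → X → X}
    {x : X} (hx : x ∈ equicontinuousPoints Φ) : ¬ Sensitive Φ := by
  rintro ⟨ε, hε, hs⟩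
  obtain ⟨δ, hδ, hst⟩ := hx ε hε
  obtain ⟨y, hy, t, ht⟩ := hs x δ hδ
  exact absurd (hst y hy t) (not_lt.2 ht)

theorem nonempty_of_mem_residual [Finite A] [Nonempty A] {s : Set (Config A)}
    (hs : s ∈ residual (Config A)) : s.Nonempty :=
  (dense_of_mem_residual hs).nonempty

theorem AlmostEquicontinuous.not_sensitive [Finite A] [Nonempty A]
    {Φ : ℕ → Config A → Config A} (h : AlmostEquicontinuous Φ) : ¬ Sensitive Φ := by
  obtain ⟨x, hx⟩ := nonempty_of_mem_residual h
  exact not_sensitive_of_mem_equicontinuousPoints hx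

/-! ### Almost equicontinuity from a single blocking word -/

/-- `h` is a curve with variation at most `M`. -/
def Variation (h : ℕ → ℤ) (M : ℕ) : Prop := ∀ t, h t - M ≤ h (t + 1) ∧ h (t + 1) ≤ h t + M

theorem exists_variation {h : ℕ → ℤ} (hh : h ∈ curves) : ∃ M, Variation h M := by
  obtain ⟨M, hM⟩ := hh
  refine ⟨M.natAbs, fun t => ?_⟩
  have := abs_le.1 (hM t)
  omega

/-- A blocking word `u` along `h`, with all the constants that the arguments below need: a margin
`K` which no information can cross within one step, and a word long enough to contain the forced
window of time `0`. -/
structure IsBlock (F : Config A → Config A) (r : ℕ) (h : ℕ → ℤ) (M K : ℕ) (u : Config A)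
    (n : ℕ) : Prop where
  radius : HasRadius F r
  variation : Variation h M
  margin : M + r ≤ K
  init : (h 0).natAbs + K ≤ n
  blocking : Blocking F h K u n

theorem Blocking.exists_isBlock (hF : HasRadius F r) {M k : ℕ} (hM : Variation h M)
    (hk : M + r ≤ k) {u : Config A} {n : ℕ} (hu : Blocking F h k u n) :
    ∃ N, IsBlock F r h M k u N :=
  ⟨n + ((h 0).natAbs + k), hF, hM, hk, by omega, hu.mono (by omega) le_rfl⟩

namespace IsBlock

variable {M K n : ℕ} {u : Config A}

/-- The half-plane to the left of a blocking word does not depend on what is to the right of it. -/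
theorem eq_left (hb : IsBlock F r h M K u n) {x y : Config A} (hx : Agree n u x)
    (hxy : ∀ j ≤ (n : ℤ), x j = y j) (t : ℕ) (i : ℤ) (hi : i ≤ h t + K) :
    F^[t] x i = F^[t] y i := by
  have hy : Agree n u y := fun j h1 h2 => (hx j h1 h2).trans (hxy j h2)
  have hm := hb.margin
  have h0 := hb.init
  refine hb.radius.eq_of_region (fun t i => i ≤ h t + K) (fun i hi => hxy i (by omega)) ?_ t i hi
  intro t i hi
  by_cases hlow : h (t + 1) - K ≤ i
  · left
    rw [hb.blocking _ _ hlow hi x hx, hb.blocking _ _ hlow hi y hy]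
  · right
    intro j h1 h2
    have := hb.variation t
    omega

/-- The half-plane to the right of a blocking word does not depend on what is to the left of it. -/
theorem eq_right (hb : IsBlock F r h M K u n) {x y : Config A} (hx : Agree n u x)
    (hxy : ∀ j ≥ (-n : ℤ), x j = y j) (t : ℕ) (i : ℤ) (hi : h t - K ≤ i) :
    F^[t] x i = F^[t] y i := by
  have hy : Agree n u y := fun j h1 h2 => (hx j h1 h2).trans (hxy j h1)
  have hm := hb.margin
  have h0 := hb.init
  refine hb.radius.eq_of_region (fun t i => h t - K ≤ i) (fun i hi => hxy i (by omega)) ?_ t i hi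
  intro t i hi
  by_cases hlow : i ≤ h (t + 1) + K
  · left
    rw [hb.blocking _ _ hi hlow x hx, hb.blocking _ _ hi hlow y hy]
  · right
    intro j h1 h2
    have := hb.variation t
    omega

/-- Everything between two occurrences of a blocking word is forced. -/
theorem forced_between (hb : IsBlock F r h M K u n) {v : Config A} {q₁ q₂ : ℤ} {N : ℕ}
    (h1 : Occurs u n v q₁) (h2 : Occurs u n v q₂)
    (hN1 : n + q₁.natAbs ≤ N) (hN2 : n + q₂.natAbs ≤ N) (t : ℕ) (i : ℤ)
    (hi1 : h t + q₁ - K ≤ i) (hi2 : i ≤ h t + q₂ + K) : Forced F v N t i := by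
  intro x hx
  have hm := hb.margin
  have h0 := hb.init
  refine hb.radius.eq_of_region (fun t i => h t + q₁ - K ≤ i ∧ i ≤ h t + q₂ + K)
    (fun i hi => (hx i (by omega) (by omega)).symm) ?_ t i ⟨hi1, hi2⟩
  rintro t i ⟨hi1, hi2⟩
  by_cases c1 : i ≤ h (t + 1) + q₁ + K
  · left
    have := h1.forced hb.radius (hb.blocking (t + 1) (i - q₁) (by omega) (by omega)) hN1
    rw [sub_add_cancel] at this
    exact this x hx
  by_cases c2 : h (t + 1) + q₂ - K ≤ i
  · left
    have := h2.forced hb.radius (hb.blocking (t + 1) (i - q₂) (by omega) (by omega)) hN2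
    rw [sub_add_cancel] at this
    exact this x hx
  right
  intro j h3 h4
  have := hb.variation t
  constructor <;> omega

theorem mem_equicontinuousPoints (hb : IsBlock F r h M K u n) {x : Config A}
    (hl : ∀ P : ℕ, ∃ q, q ≤ -(P : ℤ) ∧ Occurs u n x q)
    (hr : ∀ P : ℕ, ∃ q, (P : ℤ) ≤ q ∧ Occurs u n x q) :
    x ∈ equicontinuousPoints (along F h) := by
  rw [hb.radius.mem_equicontinuousPoints_iff]
  intro k
  obtain ⟨q₁, hq₁, ho₁⟩ := hl k
  obtain ⟨q₂, hq₂, ho₂⟩ := hr k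
  refine ⟨n + q₁.natAbs + q₂.natAbs, fun t i h1 h2 => ?_⟩
  exact hb.forced_between ho₁ ho₂ (by omega) (by omega) t i (by omega) (by omega)

end IsBlock

theorem isOpen_setOf_occurs (u : Config A) (n : ℕ) (p : ℤ → Prop) :
    IsOpen {x | ∃ q, p q ∧ Occurs u n x q} := by
  rw [isOpen_iff_agree]
  rintro x ⟨q, hq, ho⟩
  exact ⟨n + q.natAbs, fun y hy => ⟨q, hq, ho.of_agree le_rfl hy⟩⟩

/-- The configuration `x` with the word of `u` on `[-n, n]` written around the position `q`. -/
def overwrite (x u : Config A) (n : ℕ) (q : ℤ) : Config A := fun j =>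
  if q - n ≤ j ∧ j ≤ q + n then u (j - q) else x j

theorem occurs_overwrite (x u : Config A) (n : ℕ) (q : ℤ) : Occurs u n (overwrite x u n q) q := by
  intro j h1 h2
  rw [shiftPow_apply, overwrite, if_pos (by omega), add_sub_cancel_right]

theorem agree_overwrite (x u : Config A) {n m : ℕ} {q : ℤ} (hq : m + n < q.natAbs) :
    Agree m x (overwrite x u n q) := by
  intro j h1 h2
  rw [overwrite, if_neg (by omega)]

theorem dense_setOf_occurs (u : Config A) (n : ℕ) (p : ℤ → Prop)
    (hp : ∀ N : ℕ, ∃ q, p q ∧ N < q.natAbs) :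
    Dense {x | ∃ q, p q ∧ Occurs u n x q} := by
  intro x
  rw [mem_closure_iff_nhds]
  intro s hs
  obtain ⟨m, hm⟩ := mem_nhds_iff_agree.1 hs
  obtain ⟨q, hq, hN⟩ := hp (m + n)
  exact ⟨overwrite x u n q, hm (agree_overwrite x u hN), q, hq, occurs_overwrite x u n q⟩

/-- A generic configuration carries a blocking word infinitely often on both sides. -/
theorem IsBlock.almostEquicontinuous {M K n : ℕ} {u : Config A} (hb : IsBlock F r h M K u n) :
    AlmostEquicontinuous (along F h) := by
  have h1 : ∀ P : ℕ, {x | ∃ q, q ≤ -(P : ℤ) ∧ Occurs u n x q} ∈ residual (Config A) := fun P =>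
    residual_of_dense_open (isOpen_setOf_occurs u n _)
      (dense_setOf_occurs u n _ fun N => ⟨-(P + N + 1), by omega, by omega⟩)
  have h2 : ∀ P : ℕ, {x | ∃ q, (P : ℤ) ≤ q ∧ Occurs u n x q} ∈ residual (Config A) := fun P =>
    residual_of_dense_open (isOpen_setOf_occurs u n _)
      (dense_setOf_occurs u n _ fun N => ⟨P + N + 1, by omega, by omega⟩)
  filter_upwards [countable_iInter_mem.2 h1, countable_iInter_mem.2 h2] with x hx1 hx2
  exact hb.mem_equicontinuousPoints (fun P => Set.mem_iInter.1 hx1 P)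
    (fun P => Set.mem_iInter.1 hx2 P)

theorem HasRadius.exists_isBlock (hF : HasRadius F r) {h : ℕ → ℤ} (hh : h ∈ curves)
    (hs : ¬ Sensitive (along F h)) : ∃ M K u n, IsBlock F r h M K u n := by
  obtain ⟨M, hM⟩ := exists_variation hh
  obtain ⟨u, n, hu⟩ := hF.exists_blocking_of_not_sensitive hs (M + r)
  obtain ⟨N, hN⟩ := hu.exists_isBlock hF hM le_rfl
  exact ⟨M, M + r, u, N, hN⟩

theorem HasRadius.almostEquicontinuous_of_blocking (hF : HasRadius F r) {h : ℕ → ℤ}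
    (hh : h ∈ curves) (hu : ∀ k, ∃ u n, Blocking F h k u n) :
    AlmostEquicontinuous (along F h) := by
  obtain ⟨M, hM⟩ := exists_variation hh
  obtain ⟨u, n, hu⟩ := hu (M + r)
  obtain ⟨N, hN⟩ := hu.exists_isBlock hF hM le_rfl
  exact hN.almostEquicontinuous

theorem HasRadius.almostEquicontinuous_of_not_sensitive (hF : HasRadius F r) {h : ℕ → ℤ}
    (hh : h ∈ curves) (hs : ¬ Sensitive (along F h)) : AlmostEquicontinuous (along F h) := by
  obtain ⟨M, K, u, n, hb⟩ := hF.exists_isBlock hh hs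
  exact hb.almostEquicontinuous

end GenericLimit

namespace GenericLimit

/-! ### Realms and generic limit sets -/

section Realm

variable {X : Type*} [MetricSpace X] {Φ : ℕ → X → X}

theorem isClosed_genericLimitSet : IsClosed (genericLimitSet Φ) :=
  isClosed_sInter fun _ hV => hV.1

theorem genericLimitSet_subset {V : Set X} (hV : IsClosed V) (hr : realm Φ V ∈ residual X) :
    genericLimitSet Φ ⊆ V :=
  Set.sInter_subset_of_mem ⟨hV, hr⟩

variable [CompactSpace X]

theorem mem_realm_iff {V : Set X} (hV : IsClosed V) {x : X} :
    x ∈ realm Φ V ↔ ∀ N, IsOpen N → V ⊆ N → ∀ᶠ t in atTop, Φ t x ∈ N := by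
  constructor
  · intro hx N hN hVN
    have := eventually_mapsTo_of_isOpen_of_omegaLimit_subset atTop Φ {x} hN (hx.trans hVN)
    filter_upwards [this] with t ht using ht rfl
  · intro hx y hy
    by_contra hyV
    rw [mem_omegaLimit_singleton_iff_mapClusterPt] at hy
    obtain ⟨ε, hε, hball⟩ := Metric.nhds_basis_closedBall.mem_iff.1
      (hV.isOpen_compl.mem_nhds hyV)
    have hev := hx (Metric.closedBall y ε)ᶜ Metric.isClosed_closedBall.isOpen_compl
      (fun z hz hz' => hball hz' hz)
    have hfr := mapClusterPt_iff_frequently.1 hy _ (Metric.closedBall_mem_nhds y hε)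
    obtain ⟨t, ht1, ht2⟩ := (hfr.and_eventually hev).exists
    exact ht2 ht1

theorem realm_genericLimitSet_mem_residual : realm Φ (genericLimitSet Φ) ∈ residual X := by
  obtain ⟨S, hSc, hS, hSU⟩ := TopologicalSpace.isOpen_sUnion_countable
    (compl '' {V : Set X | IsClosed V ∧ realm Φ V ∈ residual X})
    (by rintro _ ⟨V, hV, rfl⟩; exact hV.1.isOpen_compl)
  have hres : ⋂₀ ((fun U => realm Φ Uᶜ) '' S) ∈ residual X := by
    refine (countable_sInter_mem (hSc.image _)).2 ?_
    rintro _ ⟨U, hU, rfl⟩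
    obtain ⟨V, hV, rfl⟩ := hS hU
    simpa using hV.2
  filter_upwards [hres] with x hx y hy
  by_contra hy'
  have hyU : y ∈ ⋃₀ (compl '' {V : Set X | IsClosed V ∧ realm Φ V ∈ residual X}) := by
    simp only [genericLimitSet, Set.mem_sInter, not_forall] at hy'
    obtain ⟨V, hV, hyV⟩ := hy'
    exact ⟨Vᶜ, ⟨V, hV, rfl⟩, hyV⟩
  rw [← hSU] at hyU
  obtain ⟨U, hU, hyU⟩ := hyU
  exact hx _ ⟨U, hU, rfl⟩ hy hyU

/-- Baire category: a clopen neighbourhood `N` of a set with comeager realm attracts some open set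
uniformly, and such open sets are found everywhere. -/
theorem exists_open_forall_mem (hΦ : ∀ t, Continuous (Φ t)) {V N : Set X} (hV : IsClosed V)
    (hr : realm Φ V ∈ residual X) (hN : IsClopen N) (hVN : V ⊆ N) {O : Set X} (hO : IsOpen O)
    (hne : O.Nonempty) :
    ∃ O' ⊆ O, IsOpen O' ∧ O'.Nonempty ∧ ∃ T, ∀ x ∈ O', ∀ t ≥ T, Φ t x ∈ N := by
  let C : ℕ → Set X := fun T => {x | ∀ t ≥ T, Φ t x ∈ N}
  have hC : ∀ T, IsClosed (C T) := fun T => by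
    have : C T = ⋂ t, ⋂ (_ : t ≥ T), Φ t ⁻¹' N := by
      ext x
      simp [C]
    rw [this]
    exact isClosed_iInter fun t => isClosed_iInter fun _ => hN.1.preimage (hΦ t)
  by_contra hcon
  have hint : ∀ T, ¬ (interior (C T) ∩ O).Nonempty := fun T hT =>
    hcon ⟨interior (C T) ∩ O, Set.inter_subset_right, isOpen_interior.inter hO, hT, T,
      fun x hx t ht => interior_subset hx.1 t ht⟩
  have hG : ∀ T, (C T)ᶜ ∪ (closure O)ᶜ ∈ residual X := fun T => by
    refine residual_of_dense_open ((hC T).isOpen_compl.union isClosed_closure.isOpen_compl) ?_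
    rw [← Set.compl_inter, ← interior_eq_empty_iff_dense_compl, interior_inter,
      ← Set.not_nonempty_iff_eq_empty]
    rintro ⟨x, hx1, hx2⟩
    obtain ⟨y, ⟨hy1, hy2⟩, hy3⟩ := mem_closure_iff.1 (interior_subset hx2) _
      (isOpen_interior.inter isOpen_interior) ⟨hx1, hx2⟩
    exact hint T ⟨y, hy1, hy3⟩
  obtain ⟨x, hxO, hx1, hx2⟩ := (dense_of_mem_residual
    (Filter.inter_mem (countable_iInter_mem.2 hG) hr)).inter_open_nonempty O hO hne
  obtain ⟨T, hT⟩ := eventually_atTop.1 ((mem_realm_iff hV).1 hx2 N hN.2 hVN)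
  rcases Set.mem_iInter.1 hx1 T with h | h
  · exact h hT
  · exact h (subset_closure hxO)

end Realm

/-! ### A finite generic limit set forces almost equicontinuity -/

variable {A : Type*} {F : Config A → Config A} {r : ℕ} {h h' : ℕ → ℤ}

theorem exists_separating_window {Y : Set (Config A)} (hY : Y.Finite) :
    ∃ k, ∀ y ∈ Y, ∀ z ∈ Y, Agree k y z → y = z := by
  refine ⟨(hY.toFinset ×ˢ hY.toFinset).sup fun p => firstDiff p.1 p.2, fun y hy z hz hyz => ?_⟩
  by_contra hne
  have hle : firstDiff y z ≤ (hY.toFinset ×ˢ hY.toFinset).sup fun p => firstDiff p.1 p.2 :=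
    Finset.le_sup (f := fun p : Config A × Config A => firstDiff p.1 p.2) (b := (y, z))
      (by simp [hy, hz])
  have := hyz.mono hle
  rcases firstDiff_mem hne with h' | h'
  · exact h' (this _ (by omega) le_rfl)
  · exact h' (this _ le_rfl (by omega))

theorem isClopen_setOf_agree {Y : Set (Config A)} (hY : Y.Finite) (k : ℕ) :
    IsClopen {x | ∃ y ∈ Y, Agree k y x} := by
  have : {x | ∃ y ∈ Y, Agree k y x} = ⋃ y ∈ Y, {x | Agree k y x} := by
    ext x
    simp
  rw [this]
  exact ⟨hY.isClosed_biUnion fun y _ => isClosed_agree y k,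
    isOpen_biUnion fun y _ => isOpen_agree y k⟩

/-- If the generic limit set along `h` is finite, then some cylinder of configurations enters, in
finite time and forever, a neighbourhood of it in which the trajectory is driven by the finitely
many possible central windows; a subcylinder fixing one such window is then blocking. -/
theorem HasRadius.exists_blocking_of_finite [Finite A] [Nonempty A] (hF : HasRadius F r)
    (hh : h ∈ curves) (hY : (genericLimitSet (along F h)).Finite) (k : ℕ) :
    ∃ u n, Blocking F h k u n := by
  obtain ⟨M, hM⟩ := exists_variation hh
  obtain ⟨k₀, hk₀⟩ := exists_separating_window hY
  let K := k + k₀ + M + r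
  obtain ⟨O, -, hO, ⟨u, hu⟩, T, hT⟩ := exists_open_forall_mem (hF.continuous_along h)
    isClosed_genericLimitSet realm_genericLimitSet_mem_residual (isClopen_setOf_agree hY K)
    (fun y hy => ⟨y, hy, Agree.refl K y⟩) isOpen_univ Set.univ_nonempty
  obtain ⟨n, hn⟩ := isOpen_iff_agree.1 hO u hu
  obtain ⟨N, hN⟩ := hF.exists_forced_lt h K (T + 1)
  have main : ∀ x, Agree (n + N) u x → ∀ t ≥ T, Agree K (along F h t u) (along F h t x) := by
    intro x hx t ht
    induction t, ht using Nat.le_induction with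
    | base =>
      rw [hF.agree_along_iff]
      exact fun i h1 h2 => (hN u T (Nat.lt_succ_self T) i h1 h2 x (hx.mono (by omega))).symm
    | succ t ht ih =>
      obtain ⟨y, hy, hyu⟩ := hT u hu (t + 1) (by omega)
      obtain ⟨z, hz, hzx⟩ := hT x (hn (hx.mono (by omega))) (t + 1) (by omega)
      -- The two windows at time `t + 1` agree on the smaller, but separating, radius `k₀`.
      have hsmall : Agree k₀ (along F h (t + 1) u) (along F h (t + 1) x) := by
        rw [hF.agree_along_iff] at ih ⊢
        intro i h1 h2
        rw [Function.iterate_succ_apply', Function.iterate_succ_apply']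
        refine hF.congr _ _ _ fun j h3 h4 => ih j ?_ ?_ <;> have := hM t <;> omega
      have hyz : y = z := hk₀ y hy z hz
        (((hyu.mono (by omega)).trans hsmall).trans (hzx.symm.mono (by omega)))
      subst hyz
      exact hyu.symm.trans hzx
  refine ⟨u, n + N, fun t i h1 h2 x hx => ?_⟩
  rcases lt_or_ge t T with ht | ht
  · exact hN u t (by omega) i (by omega) (by omega) x (hx.mono (by omega))
  · exact ((hF.agree_along_iff h K t u x).1 (main x hx t ht) i (by omega) (by omega)).symm

theorem HasRadius.infinite_of_sensitive [Finite A] [Nonempty A] (hF : HasRadius F r)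
    (hh : h ∈ curves) (hs : Sensitive (along F h)) : (genericLimitSet (along F h)).Infinite :=
  fun hY => (hF.almostEquicontinuous_of_blocking hh
    (hF.exists_blocking_of_finite hh hY)).not_sensitive hs

theorem SameDir.exists_bound (hs : SameDir h h') :
    ∃ C : ℕ, ∀ t, h t ≤ h' t + C ∧ h' t ≤ h t + C := by
  obtain ⟨⟨C, hC⟩, D, hD⟩ := hs
  refine ⟨C + D, fun t => ?_⟩
  have h1 := hC t
  have h2 := hD t
  omega

theorem HasRadius.along_eq_shiftPow (hF : HasRadius F r) (h h' : ℕ → ℤ) (t : ℕ) (x : Config A) :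
    along F h t x = shiftPow (h t - h' t) (along F h' t x) := by
  funext i
  rw [shiftPow_apply, hF.along_apply, hF.along_apply]
  rw [add_assoc, sub_add_cancel]

theorem HasRadius.finite_of_sameDir [Finite A] (hF : HasRadius F r) (hs : SameDir h h')
    (hY : (genericLimitSet (along F h')).Finite) : (genericLimitSet (along F h)).Finite := by
  obtain ⟨C, hC⟩ := hs.exists_bound
  set Y := genericLimitSet (along F h') with hYdef
  let V : Set (Config A) := ⋃ b ∈ Set.Icc (-C : ℤ) C, shiftPow b '' Y
  have hV : V.Finite := (Set.finite_Icc _ _).biUnion fun b _ => hY.image _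
  refine hV.subset (genericLimitSet_subset hV.isClosed ?_)
  filter_upwards [realm_genericLimitSet_mem_residual (Φ := along F h')] with x hx
  rw [mem_realm_iff hV.isClosed]
  intro N hN hVN
  have hev := (mem_realm_iff isClosed_genericLimitSet).1 hx
    (⋂ b ∈ Set.Icc (-C : ℤ) C, shiftPow b ⁻¹' N)
    ((Set.finite_Icc _ _).isOpen_biInter fun b _ => hN.preimage (continuous_shiftPow b))
    (fun y hy => Set.mem_iInter₂.2 fun b hb =>
      hVN (Set.mem_iUnion₂.2 ⟨b, hb, y, hy, rfl⟩))
  filter_upwards [hev] with t ht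
  rw [hF.along_eq_shiftPow h h']
  have := hC t
  exact Set.mem_iInter₂.1 ht (h t - h' t) ⟨by omega, by omega⟩

theorem HasRadius.isEquicontinuous_of_sameDir (hF : HasRadius F r) (hs : SameDir h h')
    (he : IsEquicontinuous (along F h')) : IsEquicontinuous (along F h) := by
  obtain ⟨C, hC⟩ := hs.exists_bound
  refine Set.eq_univ_of_forall fun x => ?_
  rw [hF.mem_equicontinuousPoints_iff]
  intro k
  have hx : x ∈ equicontinuousPoints (along F h') := by
    rw [he]
    trivial
  obtain ⟨n, hn⟩ := (hF.mem_equicontinuousPoints_iff h' x).1 hx (k + C)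
  refine ⟨n, fun t i h1 h2 => hn t i ?_ ?_⟩ <;> have := hC t <;> omega

end GenericLimit

namespace GenericLimit

/-! ### The directions of almost equicontinuity form a closed interval -/

variable {A : Type*} {F : Config A → Config A} {r : ℕ} {h h' : ℕ → ℤ}

/-- Information does not travel faster than `r`: a word cannot force cells out of its light cone,
unless `F` is nilpotent. -/
theorem Forced.bounds (hF : HasRadius F r) (hnil : ¬ Nilpotent (iterates F)) {u : Config A}
    {n t : ℕ} {i : ℤ} (hu : Forced F u n t i) :
    -(n + (r * t : ℕ) : ℤ) ≤ i ∧ i ≤ n + (r * t : ℕ) := by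
  by_contra hcon
  refine hnil (hF.nilpotent_of_const t i (F^[t] u i) fun x => ?_)
  rw [← hu (overwrite x u n 0) (by simpa [Occurs] using occurs_overwrite x u n 0)]
  refine (hF.iterate t).congr _ _ _ fun j h1 h2 => ?_
  rw [overwrite, if_neg (by omega)]

namespace IsBlock

variable {M K n M' K' n' : ℕ} {u u' : Config A}

/-- What a word `u'` forces to the left of a blocking word `u`, when placed to the right of `u`, is
in fact forced by `u` alone, since it cannot depend on the presence of `u'`. -/
theorem forced_of_forced_right (hb : IsBlock F r h M K u n) {t : ℕ} {i : ℤ} {p : ℕ}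
    (hp : n + n' < p) (hu' : Forced F u' n' t (i - p)) (hi : i ≤ h t + K) :
    Forced F u n t i := by
  have key : ∀ x, Agree n u x → F^[t] x i = F^[t] u' (i - p) := fun x hx => by
    rw [hb.eq_left hx (y := overwrite x u' n' p) (fun j hj => ?_) t i hi]
    · have := (occurs_overwrite x u' n' p).apply_eq hb.radius hu'
      rwa [sub_add_cancel] at this
    · rw [overwrite, if_neg (by omega)]
  exact fun x hx => (key x hx).trans (key u (Agree.refl n u)).symm

theorem forced_of_forced_left (hb : IsBlock F r h M K u n) {t : ℕ} {i : ℤ} {p : ℕ}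
    (hp : n + n' < p) (hu' : Forced F u' n' t (i + p)) (hi : h t - K ≤ i) :
    Forced F u n t i := by
  have key : ∀ x, Agree n u x → F^[t] x i = F^[t] u' (i + p) := fun x hx => by
    rw [hb.eq_right hx (y := overwrite x u' n' (-p)) (fun j hj => ?_) t i hi]
    · have := (occurs_overwrite x u' n' (-p)).apply_eq hb.radius hu'
      rwa [add_neg_cancel_right] at this
    · rw [overwrite, if_neg (by omega)]
  exact fun x hx => (key x hx).trans (key u (Agree.refl n u)).symm

/-- A blocking word along `h` forces everything between `h'` and `h`, as soon as there is some
blocking word along `h'`. -/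
theorem forced_from (hb : IsBlock F r h M K u n) (hb' : IsBlock F r h' M' K' u' n') (t : ℕ)
    (i : ℤ) (h1 : h' t + (n + n' + 1 : ℕ) ≤ i) (h2 : i ≤ h t + K) : Forced F u n t i := by
  intro x hx
  have hm := hb.margin
  have hm' := hb'.margin
  have h0 := hb.init
  have h0' := hb'.init
  refine hb.radius.eq_of_region (fun t i => h' t + (n + n' + 1 : ℕ) ≤ i ∧ i ≤ h t + K)
    (fun i hi => (hx i (by omega) (by omega)).symm) ?_ t i ⟨h1, h2⟩
  rintro t i ⟨h1, h2⟩
  by_cases c1 : i ≤ h' (t + 1) + (n + n' + 1 : ℕ) + K'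
  · exact Or.inl (hb.forced_of_forced_right (p := n + n' + 1) (by omega)
      (hb'.blocking (t + 1) _ (by omega) (by omega)) h2 x hx)
  by_cases c2 : h (t + 1) - K ≤ i
  · exact Or.inl (hb.blocking (t + 1) i c2 h2 x hx)
  right
  intro j h3 h4
  have := hb.variation t
  have := hb'.variation t
  constructor <;> omega

theorem forced_to (hb : IsBlock F r h M K u n) (hb' : IsBlock F r h' M' K' u' n') (t : ℕ)
    (i : ℤ) (h1 : h t - K ≤ i) (h2 : i ≤ h' t - (n + n' + 1 : ℕ)) : Forced F u n t i := by
  intro x hx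
  have hm := hb.margin
  have hm' := hb'.margin
  have h0 := hb.init
  have h0' := hb'.init
  refine hb.radius.eq_of_region (fun t i => h t - K ≤ i ∧ i ≤ h' t - (n + n' + 1 : ℕ))
    (fun i hi => (hx i (by omega) (by omega)).symm) ?_ t i ⟨h1, h2⟩
  rintro t i ⟨h1, h2⟩
  by_cases c1 : h' (t + 1) - (n + n' + 1 : ℕ) - K' ≤ i
  · exact Or.inl (hb.forced_of_forced_left (p := n + n' + 1) (by omega)
      (hb'.blocking (t + 1) _ (by omega) (by omega)) h1 x hx)
  by_cases c2 : i ≤ h (t + 1) + K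
  · exact Or.inl (hb.blocking (t + 1) i h1 c2 x hx)
  right
  intro j h3 h4
  have := hb.variation t
  have := hb'.variation t
  constructor <;> omega

end IsBlock

/-- The left end of the interval of cells around `h t` forced at time `t` by the word `u`. It is
meaningful when `h t` is forced and `F` is not nilpotent, so that the infimum is attained. -/
noncomputable def leftEnd (F : Config A → Config A) (h : ℕ → ℤ) (u : Config A) (n t : ℕ) : ℤ :=
  sInf {i | ∀ j, i ≤ j → j ≤ h t → Forced F u n t j}

/-- The right end of the interval of cells around `h t` forced at time `t` by the word `u`. -/
noncomputable def rightEnd (F : Config A → Config A) (h : ℕ → ℤ) (u : Config A) (n t : ℕ) : ℤ :=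
  sSup {i | ∀ j, h t ≤ j → j ≤ i → Forced F u n t j}

namespace IsBlock

variable {M K n M' K' n' : ℕ} {u u' : Config A}

theorem bddBelow_left (hb : IsBlock F r h M K u n) (hnil : ¬ Nilpotent (iterates F)) (t : ℕ) :
    BddBelow {i | ∀ j, i ≤ j → j ≤ h t → Forced F u n t j} := by
  refine ⟨min (h t) (-(n + (r * t : ℕ) : ℤ)), fun i hi => ?_⟩
  by_contra hlt
  have := (hi i le_rfl (by omega)).bounds hb.radius hnil
  omega

theorem bddAbove_right (hb : IsBlock F r h M K u n) (hnil : ¬ Nilpotent (iterates F)) (t : ℕ) :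
    BddAbove {i | ∀ j, h t ≤ j → j ≤ i → Forced F u n t j} := by
  refine ⟨max (h t) (n + (r * t : ℕ) : ℤ), fun i hi => ?_⟩
  by_contra hlt
  have := (hi i (by omega) le_rfl).bounds hb.radius hnil
  omega

theorem leftEnd_le (hb : IsBlock F r h M K u n) (hnil : ¬ Nilpotent (iterates F)) {t : ℕ} {i : ℤ}
    (hi : ∀ j, i ≤ j → j ≤ h t → Forced F u n t j) : leftEnd F h u n t ≤ i :=
  csInf_le (hb.bddBelow_left hnil t) hi

theorem le_rightEnd (hb : IsBlock F r h M K u n) (hnil : ¬ Nilpotent (iterates F)) {t : ℕ} {i : ℤ}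
    (hi : ∀ j, h t ≤ j → j ≤ i → Forced F u n t j) : i ≤ rightEnd F h u n t :=
  le_csSup (hb.bddAbove_right hnil t) hi

theorem leftEnd_le_self (hb : IsBlock F r h M K u n) (hnil : ¬ Nilpotent (iterates F)) (t : ℕ) :
    leftEnd F h u n t ≤ h t :=
  hb.leftEnd_le hnil fun j h1 h2 => hb.blocking t j (by omega) (by omega)

theorem self_le_rightEnd (hb : IsBlock F r h M K u n) (hnil : ¬ Nilpotent (iterates F)) (t : ℕ) :
    h t ≤ rightEnd F h u n t :=
  hb.le_rightEnd hnil fun j h1 h2 => hb.blocking t j (by omega) (by omega)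

theorem forced_of_mem_ends (hb : IsBlock F r h M K u n) (hnil : ¬ Nilpotent (iterates F)) {t : ℕ}
    {i : ℤ} (h1 : leftEnd F h u n t ≤ i) (h2 : i ≤ rightEnd F h u n t) : Forced F u n t i := by
  have hself : ∀ j, h t ≤ j → j ≤ h t → Forced F u n t j :=
    fun j h1 h2 => hb.blocking t j (by omega) (by omega)
  rcases le_total i (h t) with hi | hi
  · exact Int.csInf_mem (s := {i | ∀ j, i ≤ j → j ≤ h t → Forced F u n t j})
      ⟨h t, hself⟩ (hb.bddBelow_left hnil t) i h1 hi
  · exact Int.csSup_mem (s := {i | ∀ j, h t ≤ j → j ≤ i → Forced F u n t j})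
      ⟨h t, hself⟩ (hb.bddAbove_right hnil t) i hi h2

theorem preceq_ends (hb : IsBlock F r h M K u n) (hnil : ¬ Nilpotent (iterates F))
    (hb' : IsBlock F r h' M' K' u' n') :
    Preceq (leftEnd F h u n) h' ∧ Preceq h' (rightEnd F h u n) := by
  refine ⟨⟨n + n' + 1, fun t => ?_⟩, n + n' + 1, fun t => ?_⟩
  · exact hb.leftEnd_le hnil fun j h1 h2 => hb.forced_from hb' t j h1 (by omega)
  · rw [← sub_le_iff_le_add]
    exact hb.le_rightEnd hnil fun j h1 h2 => hb.forced_to hb' t j (by omega) h2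

/-- Two distant copies of a blocking word along `h` force, up to any additive constant, the whole
interval between the ends. -/
theorem exists_blocking_of_preceq (hb : IsBlock F r h M K u n) (hnil : ¬ Nilpotent (iterates F))
    (h1 : Preceq (leftEnd F h u n) h') (h2 : Preceq h' (rightEnd F h u n)) (k : ℕ) :
    ∃ v N, Blocking F h' k v N := by
  obtain ⟨C, hC⟩ := h1
  obtain ⟨D, hD⟩ := h2
  obtain ⟨P, hP⟩ : ∃ P : ℕ, P = C + D + k + n + 1 := ⟨_, rfl⟩
  let v := overwrite (shiftPow P u) u n P
  have ho₁ : Occurs u n v (-P) := by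
    intro j h1 h2
    simp only [v, shiftPow_apply, overwrite]
    rw [if_neg (by omega), neg_add_cancel_right]
  have ho₂ : Occurs u n v P := occurs_overwrite _ _ _ _
  refine ⟨v, n + P, fun t i h1 h2 => ?_⟩
  have h3 := hC t
  have h4 := hD t
  by_cases c1 : i + P ≤ h t
  · have := ho₁.forced hb.radius (N := n + P) (hb.forced_of_mem_ends hnil (t := t) (i := i + P)
      (by omega) (c1.trans (hb.self_le_rightEnd hnil t))) (by omega)
    rwa [add_neg_cancel_right] at this
  by_cases c2 : h t ≤ i - P
  · have := ho₂.forced hb.radius (N := n + P) (hb.forced_of_mem_ends hnil (t := t) (i := i - P)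
      ((hb.leftEnd_le_self hnil t).trans c2) (by omega)) (by omega)
    rwa [sub_add_cancel] at this
  exact hb.forced_between ho₁ ho₂ (by omega) (by omega) t i (by omega) (by omega)

theorem almostEquicontinuous_iff [Finite A] [Nonempty A] (hb : IsBlock F r h M K u n)
    (hnil : ¬ Nilpotent (iterates F)) (hh' : h' ∈ curves) :
    AlmostEquicontinuous (along F h') ↔
      Preceq (leftEnd F h u n) h' ∧ Preceq h' (rightEnd F h u n) := by
  constructor
  · intro hae
    obtain ⟨M', K', u', n', hb'⟩ := hb.radius.exists_isBlock hh' hae.not_sensitive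
    exact hb.preceq_ends hnil hb'
  · rintro ⟨h1, h2⟩
    exact hb.radius.almostEquicontinuous_of_blocking hh' (hb.exists_blocking_of_preceq hnil h1 h2)

/-- A direction with a blocking word lies in `[-ρ₊, -ρ₋]`: otherwise the cells in this direction
would see nothing of the blocking word which forces them. -/
theorem mem_nonObliqueCurves (hb : IsBlock F r h M K u n) (hnil : ¬ Nilpotent (iterates F))
    (hh : h ∈ curves) : h ∈ nonObliqueCurves F := by
  have hcast : ∀ t, ((h t : ℝ) : EReal) + ((n : ℕ) : EReal) = (((h t + n : ℤ) : ℝ) : EReal) := by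
    intro t
    push_cast
    rfl
  have hforced : ∀ t x, F^[t] (shiftPow (h t) (overwrite x u n 0)) 0 = F^[t] u (h t) := by
    intro t x
    rw [(hb.radius.iterate t).shift, shiftPow_apply, zero_add]
    exact hb.blocking t (h t) (by omega) (by omega) _
      (by simpa [Occurs] using occurs_overwrite x u n 0)
  have hshift : ∀ t x, F^[t] (shiftPow (h t) x) 0 = F^[t] x (h t) := by
    intro t x
    rw [(hb.radius.iterate t).shift, shiftPow_apply, zero_add]
  refine ⟨hh, ⟨n, fun t => ?_⟩, n, fun t => ?_⟩
  · simp only [hcast]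
    rw [EReal.neg_le, ← EReal.coe_neg]
    refine le_sInf ?_
    rintro _ ⟨i, rfl, hi⟩
    rw [EReal.coe_le_coe_iff]
    by_contra hlt
    have hlt' : i < -(h t + n) := by
      have := not_le.1 hlt
      exact_mod_cast this
    refine hnil (hb.radius.nilpotent_of_const t (h t) (F^[t] u (h t)) fun x => ?_)
    rw [← hforced t x, ← hshift t x]
    refine hi _ _ fun j hj => ?_
    rw [shiftPow_apply, shiftPow_apply, overwrite, if_neg (by omega)]
  · rw [← EReal.sub_le_iff_le_add (Or.inl (EReal.natCast_ne_bot n))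
      (Or.inl (EReal.natCast_ne_top n))]
    have hcast' : ((h t : ℝ) : EReal) - ((n : ℕ) : EReal) = (((h t - n : ℤ) : ℝ) : EReal) := by
      push_cast
      rfl
    rw [hcast', EReal.le_neg, ← EReal.coe_neg]
    refine sSup_le ?_
    rintro _ ⟨i, rfl, hi⟩
    rw [EReal.coe_le_coe_iff]
    by_contra hlt
    have hlt' : -(h t - n) < i := by
      have := not_le.1 hlt
      exact_mod_cast this
    refine hnil (hb.radius.nilpotent_of_const t (h t) (F^[t] u (h t)) fun x => ?_)
    rw [← hforced t x, ← hshift t x]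
    refine hi _ _ fun j hj => ?_
    rw [shiftPow_apply, shiftPow_apply, overwrite, if_neg (by omega)]

/-- Between its ends, taken strictly enough, a blocking word makes every configuration in which it
occurs an equicontinuous point. -/
theorem exists_dense_open (hb : IsBlock F r h M K u n) (hnil : ¬ Nilpotent (iterates F))
    (h1 : Pprec (leftEnd F h u n) h') (h2 : Pprec h' (rightEnd F h u n)) :
    ∃ U : Set (Config A), IsOpen U ∧ Dense U ∧ U ⊆ equicontinuousPoints (along F h') := by
  refine ⟨{x | ∃ q, True ∧ Occurs u n x q}, isOpen_setOf_occurs u n _,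
    dense_setOf_occurs u n _ fun N => ⟨N + 1, trivial, by omega⟩, ?_⟩
  rintro x ⟨q, -, ho⟩
  rw [hb.radius.mem_equicontinuousPoints_iff]
  intro k
  obtain ⟨T, hT⟩ := eventually_atTop.1 ((h1.eventually_ge_atTop (k + q.natAbs : ℤ)).and
    (h2.eventually_ge_atTop (k + q.natAbs : ℤ)))
  obtain ⟨N, hN⟩ := hb.radius.exists_forced_lt h' k T
  refine ⟨N + (n + q.natAbs), fun t i hi1 hi2 => ?_⟩
  rcases lt_or_ge t T with ht | ht
  · exact (hN x t ht i hi1 hi2).mono (by omega)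
  · obtain ⟨h3, h4⟩ := hT t ht
    have := ho.forced hb.radius (N := N + (n + q.natAbs))
      (hb.forced_of_mem_ends hnil (t := t) (i := i - q) (by omega) (by omega)) (by omega)
    rwa [sub_add_cancel] at this

end IsBlock

end GenericLimit

namespace GenericLimit

/-! ### Eventual periodicity of letters -/

variable {A : Type*}

/-- Every orbit of a self-map of a finite set is asymptotic to a periodic orbit, with any prescribed
delay `t₀`. -/
theorem exists_periodic_asymptotic [Finite A] (g : A → A) (b : A) (t₀ : ℕ) :
    ∃ a p, 0 < p ∧ g^[p] a = a ∧ ∃ T, ∀ t ≥ T, g^[t] b = g^[t + t₀] a := by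
  obtain ⟨i, p, hp, hip⟩ : ∃ i p : ℕ, 0 < p ∧ g^[i + p] b = g^[i] b := by
    obtain ⟨i, j, hne, hij⟩ := Finite.exists_ne_map_eq_of_infinite (fun t : ℕ => g^[t] b)
    rcases lt_or_gt_of_ne hne with hlt | hlt
    · exact ⟨i, j - i, by omega, by rw [Nat.add_sub_of_le hlt.le]; exact hij.symm⟩
    · exact ⟨j, i - j, by omega, by rw [Nat.add_sub_of_le hlt.le]; exact hij⟩
  have hper : ∀ s ≥ i, g^[s + p] b = g^[s] b := fun s hs => by
    obtain ⟨d, rfl⟩ := Nat.exists_eq_add_of_le hs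
    rw [show i + d + p = d + (i + p) by ring, Function.iterate_add_apply, hip,
      ← Function.iterate_add_apply, add_comm d]
  have hper' : ∀ s ≥ i, ∀ j, g^[s + p * j] b = g^[s] b := fun s hs j => by
    induction j with
    | zero => rfl
    | succ j ih => rw [Nat.mul_succ, ← add_assoc, hper _ (by omega), ih]
  have hle : i + t₀ ≤ p * (i + t₀) := Nat.le_mul_of_pos_left _ hp
  -- The delay is compensated by advancing `b` by `-t₀` modulo the period.
  refine ⟨g^[p * (i + t₀) - t₀] b, p, hp, ?_, i, fun t ht => ?_⟩
  · rw [← Function.iterate_add_apply, add_comm, hper _ (by omega)]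
  · rw [← Function.iterate_add_apply,
      show t + t₀ + (p * (i + t₀) - t₀) = t + p * (i + t₀) by omega, hper' t ht]

theorem iterate_add_mul_period {g : A → A} {a : A} {p : ℕ} (hp : g^[p] a = a) (s j : ℕ) :
    g^[s + p * j] a = g^[s] a := by
  rw [Function.iterate_add_apply, Function.iterate_mul]
  congr 1
  exact Function.iterate_fixed hp j

/-! ### Wide forced intervals are monochrome -/

/-- The periodic configuration obtained by repeating the word of `u` on `[-n, n]`. -/
def periodize (u : Config A) (n : ℕ) : Config A := fun j => u ((j + n) % (2 * n + 1) - n)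

theorem occurs_periodize (u : Config A) (n : ℕ) (m : ℤ) :
    Occurs u n (periodize u n) ((2 * n + 1) * m) := by
  intro j h1 h2
  rw [shiftPow_apply, periodize, add_right_comm, Int.add_mul_emod_self_left,
    Int.emod_eq_of_lt (by omega) (by omega), add_sub_cancel_right]

/-- Every interval of `2 * n + 1` consecutive integers contains a multiple of `2 * n + 1`. -/
theorem exists_mul_mem (n : ℕ) (c : ℤ) :
    ∃ m : ℤ, c - (2 * n + 1) < (2 * n + 1) * m ∧ (2 * n + 1) * m ≤ c := by
  refine ⟨c / (2 * n + 1), ?_, ?_⟩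
  · have h1 := Int.emod_lt_of_pos c (show (0 : ℤ) < 2 * n + 1 by omega)
    have h2 := Int.emod_add_mul_ediv c (2 * n + 1)
    linarith
  · have h1 := Int.emod_nonneg c (show (2 * n + 1 : ℤ) ≠ 0 by omega)
    have h2 := Int.emod_add_mul_ediv c (2 * n + 1)
    linarith

variable {F : Config A → Config A} {r : ℕ} {h h' : ℕ → ℤ} {M K n : ℕ} {u : Config A}

namespace IsBlock

/-- When the interval forced by a word is more than twice as long as the word itself, comparing the
intervals of two disjoint copies of the word shows that it is monochrome. -/
theorem eq_of_mem_ends (hb : IsBlock F r h M K u n) (hnil : ¬ Nilpotent (iterates F)) {t : ℕ}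
    (ht : leftEnd F h u n t + 2 * (2 * n + 1) ≤ rightEnd F h u n t) {i : ℤ}
    (h1 : leftEnd F h u n t ≤ i) (h2 : i ≤ rightEnd F h u n t) :
    F^[t] u i = F^[t] u (leftEnd F h u n t) := by
  have hfar : ∀ i j, leftEnd F h u n t ≤ i → i + (2 * n + 1) ≤ j → j ≤ rightEnd F h u n t →
      F^[t] u j = F^[t] u i := by
    intro i j hi hij hj
    have ho : Agree n u (overwrite u u n (j - i)) := agree_overwrite u u (by omega)
    have e1 := hb.forced_of_mem_ends hnil (by omega) hj _ ho
    have e2 := (occurs_overwrite u u n (j - i)).apply_eq hb.radius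
      (hb.forced_of_mem_ends hnil (t := t) (i := i) hi (by omega))
    rw [add_sub_cancel] at e2
    rw [← e1, e2]
  by_cases hi : leftEnd F h u n t + (2 * n + 1) ≤ i
  · exact hfar _ _ le_rfl hi h2
  · rw [← hfar i (rightEnd F h u n t) h1 (by omega) le_rfl]
    exact hfar _ _ le_rfl (by omega) le_rfl

theorem exists_iterate_periodize_eq_mono (hb : IsBlock F r h M K u n)
    (hnil : ¬ Nilpotent (iterates F))
    (hwide : ∀ L : ℤ, ∃ t, leftEnd F h u n t + L ≤ rightEnd F h u n t) :
    ∃ b t₀, F^[t₀] (periodize u n) = mono b := by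
  obtain ⟨t, ht⟩ := hwide (2 * (2 * n + 1))
  refine ⟨F^[t] u (leftEnd F h u n t), t, ?_⟩
  funext i
  obtain ⟨m, hm1, hm2⟩ := exists_mul_mem n (i - leftEnd F h u n t)
  have hocc := occurs_periodize u n m
  generalize (2 * n + 1 : ℤ) * m = q at *
  have e := hocc.apply_eq hb.radius
    (hb.forced_of_mem_ends hnil (t := t) (i := i - q) (by omega) (by omega))
  rw [sub_add_cancel] at e
  rw [e, hb.eq_of_mem_ends hnil ht (by omega) (by omega), mono_apply]

/-- A finite perturbation of the periodic configuration on a blocking word is erased at any time at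
which the forced interval is wide enough. -/
theorem exists_iterate_overwrite_eq (hb : IsBlock F r h M K u n) (hnil : ¬ Nilpotent (iterates F))
    (hwide : ∀ L : ℤ, ∃ t, leftEnd F h u n t + L ≤ rightEnd F h u n t) (x : Config A) (m : ℕ) :
    ∃ t, F^[t] (overwrite (periodize u n) x m 0) = F^[t] (periodize u n) := by
  obtain ⟨t, ht⟩ := hwide (2 * (m + n + (2 * n + 1)))
  refine ⟨t, ?_⟩
  funext i
  -- The copies of the word at a position `q` in a suitable range, on the right or on the left of
  -- the perturbation, are intact and force the cell `i`.
  have hq : ∃ c : ℤ, ∀ q, c - (2 * n + 1) < q → q ≤ c →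
      m + n < q.natAbs ∧ leftEnd F h u n t ≤ i - q ∧ i - q ≤ rightEnd F h u n t := by
    by_cases hi : m + n + (2 * n + 1) ≤ i - leftEnd F h u n t
    · exact ⟨i - leftEnd F h u n t, fun q h1 h2 => ⟨by omega, by omega, by omega⟩⟩
    · exact ⟨i - rightEnd F h u n t + (2 * n), fun q h1 h2 => ⟨by omega, by omega, by omega⟩⟩
  obtain ⟨c, hc⟩ := hq
  obtain ⟨l, hl1, hl2⟩ := exists_mul_mem n c
  have ho := occurs_periodize u n l
  obtain ⟨h1, h2, h3⟩ := hc _ hl1 hl2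
  generalize (2 * n + 1 : ℤ) * l = q at *
  have ho' : Occurs u n (overwrite (periodize u n) x m 0) q := by
    intro j hj1 hj2
    rw [ho j hj1 hj2, shiftPow_apply, shiftPow_apply, overwrite, if_neg (by omega)]
  have hu := hb.forced_of_mem_ends hnil h2 h3
  have e := ho.apply_eq hb.radius hu
  have e' := ho'.apply_eq hb.radius hu
  rw [sub_add_cancel] at e e'
  rw [e, e']

end IsBlock

/-! ### Asymptotic classes of monochrome configurations -/

theorem HasRadius.mem_asymptoticClass_iff (hF : HasRadius F r) (h : ℕ → ℤ) (x : Config A) (a : A) :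
    x ∈ asymptoticClass (along F h) (mono a) ↔
      ∀ k, ∀ᶠ t in atTop, Agree k (along F h t x) (mono ((letterMap F)^[t] a)) := by
  simp only [asymptoticClass, Set.mem_ofPred_eq, hF.along_mono]
  constructor
  · intro hx k
    filter_upwards [hx.eventually_lt_const (show (0 : ℝ) < (2 : ℝ)⁻¹ ^ k by positivity)] with t ht
    exact (dist_lt_pow_iff _ _ k).1 ht
  · intro hx
    rw [Metric.tendsto_atTop]
    intro ε hε
    obtain ⟨k, hk⟩ := exists_pow_lt hε
    obtain ⟨T, hT⟩ := eventually_atTop.1 (hx k)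
    refine ⟨T, fun t ht => ?_⟩
    rw [Real.dist_eq, sub_zero, abs_of_nonneg dist_nonneg]
    exact ((dist_lt_pow_iff _ _ k).2 (hT t ht)).trans hk

/-- If some blocking word has forced intervals of unbounded width, then the orbit of every
equicontinuous point, along any `h'`, is attracted by that of one and the same periodic monochrome
configuration. -/
theorem IsBlock.exists_asymptotic_mono [Finite A] (hb : IsBlock F r h M K u n)
    (hnil : ¬ Nilpotent (iterates F))
    (hwide : ∀ L : ℤ, ∃ t, leftEnd F h u n t + L ≤ rightEnd F h u n t) :
    ∃ a p, 0 < p ∧ (letterMap F)^[p] a = a ∧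
      ∀ h', equicontinuousPoints (along F h') ⊆ asymptoticClass (along F h') (mono a) := by
  obtain ⟨b, t₀, hb0⟩ := hb.exists_iterate_periodize_eq_mono hnil hwide
  obtain ⟨a, p, hp, hpa, T, hT⟩ := exists_periodic_asymptotic (letterMap F) b t₀
  refine ⟨a, p, hp, hpa, fun h' x hx => ?_⟩
  rw [hb.radius.mem_asymptoticClass_iff]
  rw [hb.radius.mem_equicontinuousPoints_iff] at hx
  intro k
  obtain ⟨m, hm⟩ := hx k
  obtain ⟨t₁, ht₁⟩ := hb.exists_iterate_overwrite_eq hnil hwide x m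
  filter_upwards [eventually_ge_atTop (t₁ + t₀ + T)] with t ht
  intro j h1 h2
  rw [hb.radius.along_apply, ← hm t (j + h' t) (by omega) (by omega)
    (overwrite (periodize u n) x m 0) (by simpa [Occurs] using occurs_overwrite _ x m 0)]
  have e1 : F^[t] (overwrite (periodize u n) x m 0) = F^[t] (periodize u n) := by
    rw [show t = (t - t₁) + t₁ by omega, Function.iterate_add_apply, ht₁,
      ← Function.iterate_add_apply]
  have e2 : F^[t] (periodize u n) = mono ((letterMap F)^[t] a) := by
    rw [show t = (t - t₀) + t₀ by omega, Function.iterate_add_apply, hb0,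
      hb.radius.iterate_mono, hT _ (by omega)]
  rw [e1, e2]
  rfl

theorem HasRadius.orbit_mono (hF : HasRadius F r) (a : A) :
    orbit (iterates F) (mono a) = Set.range fun t => mono ((letterMap F)^[t] a) := by
  simp only [orbit, iterates, hF.iterate_mono]

theorem HasRadius.finite_orbit_mono [Finite A] (hF : HasRadius F r) (a : A) :
    (orbit (iterates F) (mono a)).Finite := by
  rw [hF.orbit_mono]
  refine (Set.finite_range (mono : A → Config A)).subset ?_
  rintro _ ⟨t, rfl⟩
  exact ⟨_, rfl⟩

theorem exists_uniform_window {Y N : Set (Config A)} (hY : Y.Finite) (hN : IsOpen N)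
    (hYN : Y ⊆ N) : ∃ k, ∀ y ∈ Y, ∀ z, Agree k y z → z ∈ N := by
  choose! k hk using fun y (hy : y ∈ N) => isOpen_iff_agree.1 hN y hy
  exact ⟨hY.toFinset.sup k, fun y hy z hz =>
    hk y (hYN hy) (hz.mono (Finset.le_sup (hY.mem_toFinset.2 hy)))⟩

theorem HasRadius.asymptoticClass_subset_realm [Finite A] (hF : HasRadius F r) (h : ℕ → ℤ)
    {V : Set (Config A)} (hV : V.Finite) {a : A} (ha : ∀ t, mono ((letterMap F)^[t] a) ∈ V) :
    asymptoticClass (along F h) (mono a) ⊆ realm (along F h) V := by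
  intro x hx
  rw [hF.mem_asymptoticClass_iff] at hx
  rw [mem_realm_iff hV.isClosed]
  intro N hN hVN
  obtain ⟨k, hk⟩ := exists_uniform_window hV hN hVN
  filter_upwards [hx k] with t ht
  exact hk _ (ha t) _ ht.symm

/-- A trajectory with limit points in a periodic orbit of monochrome configurations eventually
follows this orbit, with some phase. -/
theorem HasRadius.realm_orbit_mono [Finite A] (hF : HasRadius F r) (hh : h ∈ curves) {a : A}
    {p : ℕ} (hp : 0 < p) (hpa : (letterMap F)^[p] a = a) :
    realm (along F h) (orbit (iterates F) (mono a)) =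
      ⋃ y ∈ orbit (iterates F) (mono a), asymptoticClass (along F h) y := by
  have hfin := hF.finite_orbit_mono a
  apply Set.Subset.antisymm
  · intro x hx
    obtain ⟨M, hM⟩ := exists_variation hh
    have hx' : ∀ k, ∀ᶠ t in atTop, ∃ q, Agree k (mono ((letterMap F)^[q] a)) (along F h t x) := by
      intro k
      filter_upwards [(mem_realm_iff hfin.isClosed).1 hx _ (isClopen_setOf_agree hfin k).2
        (fun y hy => ⟨y, hy, Agree.refl k y⟩)] with t ht
      obtain ⟨y, hy, hyt⟩ := ht
      rw [hF.orbit_mono] at hy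
      obtain ⟨q, rfl⟩ := hy
      exact ⟨q, hyt⟩
    obtain ⟨T, hT⟩ := eventually_atTop.1 (hx' (M + r))
    obtain ⟨q, hq⟩ := hT T le_rfl
    have hrec : ∀ s, along F h (T + s) x 0 = (letterMap F)^[q + s] a := by
      intro s
      induction s with
      | zero => exact (hq 0 (by omega) (by omega)).symm
      | succ s ih =>
        obtain ⟨c, hc⟩ := hT (T + s) (by omega)
        have hc0 := hc 0 (by omega) (by omega)
        rw [ih, mono_apply] at hc0
        rw [← add_assoc, ← add_assoc, Function.iterate_succ_apply', ← hc0, hF.along_apply,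
          Function.iterate_succ_apply']
        have e := hF.congr (F^[T + s] x) (mono ((letterMap F)^[c] a)) (0 + h (T + s + 1))
          fun j h1 h2 => by
            have hv := hM (T + s)
            have := hc (j - h (T + s)) (by omega) (by omega)
            rw [hF.along_apply, sub_add_cancel] at this
            exact this.symm
        have e2 := hF.iterate_mono 1 ((letterMap F)^[c] a)
        simp only [Function.iterate_one] at e2
        rw [e, e2, mono_apply]
    refine Set.mem_iUnion₂.2 ⟨mono ((letterMap F)^[q + (p - 1) * T] a), ?_, ?_⟩
    · rw [hF.orbit_mono]
      exact ⟨_, rfl⟩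
    · rw [hF.mem_asymptoticClass_iff]
      intro k
      filter_upwards [hx' k, eventually_ge_atTop T] with t ht htT
      obtain ⟨c, hc⟩ := ht
      obtain ⟨s, rfl⟩ := Nat.exists_eq_add_of_le htT
      have hc0 := hc 0 (by omega) (by omega)
      rw [hrec s, mono_apply] at hc0
      have hpT : (p - 1) * T + T = p * T := by
        rw [← Nat.succ_mul, Nat.succ_eq_add_one, Nat.sub_add_cancel hp]
      rw [← Function.iterate_add_apply,
        show T + s + (q + (p - 1) * T) = q + s + p * T by omega,
        iterate_add_mul_period hpa, ← hc0]
      exact hc.symm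
  · refine Set.iUnion₂_subset fun y hy => ?_
    rw [hF.orbit_mono] at hy
    obtain ⟨q, rfl⟩ := hy
    refine hF.asymptoticClass_subset_realm h hfin fun t => ?_
    rw [hF.orbit_mono, ← Function.iterate_add_apply]
    exact ⟨_, rfl⟩

theorem HasRadius.genericLimitSet_eq_orbit_mono [Finite A] [Nonempty A] (hF : HasRadius F r)
    {a : A} {p : ℕ} (hp : 0 < p) (hpa : (letterMap F)^[p] a = a)
    (hae : AlmostEquicontinuous (along F h))
    (hE : equicontinuousPoints (along F h) ⊆ asymptoticClass (along F h) (mono a)) :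
    genericLimitSet (along F h) = orbit (iterates F) (mono a) := by
  have hfin := hF.finite_orbit_mono a
  have hsub := hF.asymptoticClass_subset_realm h hfin (a := a) (fun t => by
    rw [hF.orbit_mono]
    exact ⟨t, rfl⟩)
  apply Set.Subset.antisymm
  · exact genericLimitSet_subset hfin.isClosed (mem_of_superset hae (hE.trans hsub))
  · rintro y hy V ⟨hV, hVr⟩
    rw [hF.orbit_mono] at hy
    obtain ⟨s, rfl⟩ := hy
    obtain ⟨x, hx1, hx2⟩ := nonempty_of_mem_residual (inter_mem hae hVr)
    by_contra hyV
    obtain ⟨k, hk⟩ := isOpen_iff_agree.1 hV.isOpen_compl _ hyV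
    have hev := (mem_realm_iff hV).1 hx2 {z | Agree k (mono ((letterMap F)^[s] a)) z}ᶜ
      (isClosed_agree _ k).isOpen_compl (fun z hz hz' => hk hz' hz)
    obtain ⟨T, hT⟩ := eventually_atTop.1
      (hev.and ((hF.mem_asymptoticClass_iff h x a).1 (hE hx1) k))
    obtain ⟨h1, h2⟩ := hT (s + p * T) ((Nat.le_mul_of_pos_left T hp).trans (Nat.le_add_left _ _))
    rw [iterate_add_mul_period hpa] at h2
    exact h1 h2.symm

/-- If all points are equicontinuous and attracted by one monochrome orbit, the convergence is
uniform by compactness, hence `F` is nilpotent. -/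
theorem HasRadius.nilpotent_of_isEquicontinuous [Finite A] (hF : HasRadius F r) {a : A}
    (he : IsEquicontinuous (along F h))
    (hE : equicontinuousPoints (along F h) ⊆ asymptoticClass (along F h) (mono a)) :
    Nilpotent (iterates F) := by
  obtain ⟨T, hT⟩ := exists_uniform_bound
    (Q := fun y m => ∀ t ≥ m, F^[t] y (h t) = (letterMap F)^[t] a)
    (fun y m m' hm hQ t ht => hQ t (hm.trans ht)) (fun x => by
      have hx : x ∈ equicontinuousPoints (along F h) := by
        rw [he]
        trivial
      obtain ⟨n, hn⟩ := (hF.mem_equicontinuousPoints_iff h x).1 hx 0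
      obtain ⟨T, hT⟩ := eventually_atTop.1 ((hF.mem_asymptoticClass_iff h x a).1 (hE hx) 0)
      refine ⟨n, T, fun y hy t ht => ?_⟩
      have := hT t ht 0 (by omega) (by omega)
      rw [hF.along_apply, zero_add] at this
      rw [hn t (h t) (by omega) (by omega) y hy, this, mono_apply])
  exact hF.nilpotent_of_const T (h T) _ fun x => hT x T le_rfl

end GenericLimit

namespace GenericLimit

/-! ### Equicontinuous directions -/

variable {A : Type*} {F : Config A → Config A} {r : ℕ} {h : ℕ → ℤ}

/-- Along a direction of equicontinuity only finitely many local rules occur, so that `F` is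
ultimately periodic up to a shift. -/
theorem HasRadius.exists_period [Finite A] [Nonempty A] (hF : HasRadius F r)
    (he : IsEquicontinuous (along F h)) :
    ∃ m p s, 0 < p ∧ ∀ x, F^[m + p] x = shiftPow s (F^[m] x) := by
  obtain ⟨n, hn⟩ := exists_uniform_bound (Q := fun y m => Blocking F h 0 y m)
    (fun y m m' hm hQ => hQ.mono hm le_rfl) (fun x => by
      have hx : x ∈ equicontinuousPoints (along F h) := by
        rw [he]
        trivial
      obtain ⟨n, hn⟩ := (hF.mem_equicontinuousPoints_iff h x).1 hx 0
      exact ⟨n, n, fun y hy => hn.congr hy⟩)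
  classical
  let ext : (Set.Icc (-n : ℤ) n → A) → Config A := fun w j =>
    if hj : j ∈ Set.Icc (-n : ℤ) n then w ⟨j, hj⟩ else Classical.arbitrary A
  let φ : ℕ → (Set.Icc (-n : ℤ) n → A) → A := fun t w => F^[t] (ext w) (h t)
  have hφ : ∀ t x, φ t (fun j => x j) = F^[t] x (h t) := fun t x =>
    hn x t (h t) (by omega) (by omega) _ fun j h1 h2 => by
      have hj : j ∈ Set.Icc (-n : ℤ) n := ⟨h1, h2⟩
      simp only [ext, dif_pos hj]
  obtain ⟨t, t', hlt, heq⟩ : ∃ t t', t < t' ∧ φ t = φ t' := by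
    obtain ⟨t, t', hne, heq⟩ := Finite.exists_ne_map_eq_of_infinite φ
    rcases lt_or_gt_of_ne hne with hlt | hlt
    · exact ⟨t, t', hlt, heq⟩
    · exact ⟨t', t, hlt, heq.symm⟩
  refine ⟨t, t' - t, h t - h t', by omega, fun x => ?_⟩
  rw [Nat.add_sub_of_le hlt.le]
  funext i
  have e := hφ t (shiftPow (i - h t') x)
  rw [heq, hφ t' (shiftPow (i - h t') x), (hF.iterate t).shift, (hF.iterate t').shift,
    shiftPow_apply, shiftPow_apply, add_sub_cancel] at e
  rw [e, shiftPow_apply, add_sub_left_comm]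

theorem iterate_add_mul_of_period {m p : ℕ} {s : ℤ}
    (hper : ∀ x, F^[m + p] x = shiftPow s (F^[m] x)) (j : ℕ) (x : Config A) :
    F^[m + p * j] x = shiftPow (s * j) (F^[m] x) := by
  induction j with
  | zero => simp
  | succ j ih =>
    rw [show m + p * (j + 1) = (m + p) + p * j by ring, Function.iterate_add_apply, hper,
      ← Function.iterate_add_apply, ih, shiftPow_shiftPow]
    congr 1
    push_cast
    ring

theorem genericLimitSet_along_subset_limitSet (h : ℕ → ℤ) :
    genericLimitSet (along F h) ⊆ limitSet (iterates F) := by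
  refine genericLimitSet_subset (isClosed_omegaLimit _ _ _) (univ_mem' fun x => ?_)
  refine Set.iInter₂_mono fun T _ => closure_mono ?_
  rintro _ ⟨t, ht, y, -, rfl⟩
  exact ⟨t, ht, shiftPow (h t) y, trivial, rfl⟩

/-- If `F` is ultimately periodic up to a shift, then along any `h` the powers `F^(m + p j)` are
shifts of `F^m`. Whether the amounts of these shifts are bounded or not, generic trajectories
accumulate on the whole image of `F^m`. -/
theorem HasRadius.range_subset_genericLimitSet [Finite A] [Nonempty A] (hF : HasRadius F r)
    {m p : ℕ} {s : ℤ} (hp : 0 < p) (hper : ∀ x, F^[m + p] x = shiftPow s (F^[m] x)) (h : ℕ → ℤ) :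
    Set.range F^[m] ⊆ genericLimitSet (along F h) := by
  rintro _ ⟨z, rfl⟩ V ⟨hV, hVr⟩
  by_contra hzV
  obtain ⟨k, hk⟩ := isOpen_iff_agree.1 hV.isOpen_compl _ hzV
  have hclopen : IsClopen {y | Agree k (F^[m] z) y}ᶜ :=
    IsClopen.compl ⟨isClosed_agree _ k, isOpen_agree _ k⟩
  have hsub : V ⊆ {y | Agree k (F^[m] z) y}ᶜ := fun y hy hy' => hk hy' hy
  let b : ℕ → ℤ := fun j => s * j + h (m + p * j)
  have halong : ∀ j x, along F h (m + p * j) x = F^[m] (shiftPow (b j) x) := fun j x => by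
    rw [along, iterate_add_mul_of_period hper, (hF.iterate m).shift, (hF.iterate m).shift,
      shiftPow_shiftPow]
  -- No shift `b j` with `j` large maps a point of `O` close to `z`.
  have main : ∀ O : Set (Config A), IsOpen O → O.Nonempty → ∃ O' ⊆ O, IsOpen O' ∧ O'.Nonempty ∧
      ∃ J, ∀ x ∈ O', ∀ j ≥ J, ¬ Agree (k + r * m) z (shiftPow (b j) x) := by
    intro O hO hne
    obtain ⟨O', hO'O, hO', hne', T, hT⟩ :=
      exists_open_forall_mem (hF.continuous_along h) hV hVr hclopen hsub hO hne
    refine ⟨O', hO'O, hO', hne', T, fun x hx j hj hag => ?_⟩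
    refine hT x hx (m + p * j) ?_ ?_
    · exact (hj.trans (Nat.le_mul_of_pos_left j hp)).trans (Nat.le_add_left _ _)
    · rw [halong]
      exact hF.agree_iterate m k _ le_rfl hag
  obtain ⟨O, -, hO, ⟨x, hx⟩, J, hJ⟩ := main Set.univ isOpen_univ Set.univ_nonempty
  obtain ⟨n, hn⟩ := isOpen_iff_agree.1 hO x hx
  -- Hence the shifts are bounded: otherwise `z` could be written far away in `x`.
  have hbdd : ∀ j ≥ J, (b j).natAbs ≤ n + (k + r * m) := by
    intro j hj
    by_contra hlt
    exact hJ _ (hn (agree_overwrite x z (n := k + r * m) (by omega))) j hj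
      (occurs_overwrite x z (k + r * m) (b j))
  -- So some shift is used infinitely often, and `z` itself, shifted back, is a contradiction.
  obtain ⟨c, hc⟩ : ∃ c : ℤ, ∀ N, ∃ j ≥ N, b j = c := by
    by_contra hcon
    push Not at hcon
    choose N hN using hcon
    let B : Finset ℤ := Finset.Icc (-(n + (k + r * m) : ℕ) : ℤ) (n + (k + r * m) : ℕ)
    have hj : b (J + B.sup N) ∈ B := by
      have := hbdd (J + B.sup N) (by omega)
      rw [Finset.mem_Icc]
      omega
    exact hN _ (J + B.sup N) ((Finset.le_sup (f := N) hj).trans (Nat.le_add_left _ _)) rfl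
  obtain ⟨O', hsub', hO', ⟨y, hy⟩, J', hJ'⟩ := main {x | Agree (k + r * m) z (shiftPow c x)}
    ((isOpen_agree z _).preimage (continuous_shiftPow c))
    ⟨shiftPow (-c) z, by simp [shiftPow_shiftPow, Agree.refl]⟩
  obtain ⟨j, hj, rfl⟩ := hc J'
  exact hJ' y hy j hj (hsub' hy)

theorem HasRadius.genericLimitSet_eq_limitSet [Finite A] [Nonempty A] (hF : HasRadius F r)
    {h' : ℕ → ℤ} (he : IsEquicontinuous (along F h')) (h : ℕ → ℤ) :
    genericLimitSet (along F h) = limitSet (iterates F) := by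
  obtain ⟨m, p, s, hp, hper⟩ := hF.exists_period he
  refine (genericLimitSet_along_subset_limitSet h).antisymm ?_
  refine Set.Subset.trans ?_ (hF.range_subset_genericLimitSet hp hper h)
  refine (omegaLimit_subset_closure_image2 atTop _ _ (Ici_mem_atTop m)).trans ?_
  refine closure_minimal ?_ (isCompact_range (hF.continuous_iterate m)).isClosed
  rintro _ ⟨t, ht, x, -, rfl⟩
  refine ⟨F^[t - m] x, ?_⟩
  rw [← Function.iterate_add_apply, Nat.add_sub_of_le ht]
  rfl

end GenericLimit

namespace GenericLimit

/-! ### Nilpotent automata -/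

variable {A : Type*} {F : Config A → Config A} {r : ℕ} {h h' : ℕ → ℤ}

theorem HasRadius.nilpotent_isEquicontinuous (hF : HasRadius F r) (hnil : Nilpotent (iterates F))
    (h : ℕ → ℤ) : IsEquicontinuous (along F h) := by
  obtain ⟨z, T, hz⟩ := hnil
  refine Set.eq_univ_of_forall fun x => ?_
  rw [hF.mem_equicontinuousPoints_iff]
  intro k
  obtain ⟨N, hN⟩ := hF.exists_forced_lt h k T
  refine ⟨N, fun t i h1 h2 => ?_⟩
  rcases lt_or_ge t T with ht | ht
  · exact hN x t ht i h1 h2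
  · intro y _
    exact congrFun ((hz y t ht).trans (hz x t ht).symm) i

theorem HasRadius.class1_of_nilpotent [Finite A] [Nonempty A] (hF : HasRadius F r)
    (hnil : Nilpotent (iterates F)) : Class1 F := by
  refine ⟨hnil, ?_⟩
  obtain ⟨z, T, hz⟩ := hnil
  obtain ⟨a, rfl⟩ : ∃ a, z = mono a :=
    ⟨_, (hz (mono (Classical.arbitrary A)) T le_rfl).symm.trans (hF.iterate_mono T _)⟩
  have hlim : ∀ h x, omegaLimit atTop (along F h) {x} = {mono a} := by
    intro h x
    ext y
    rw [mem_omegaLimit_singleton_iff_mapClusterPt, Set.mem_singleton_iff]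
    have ht : Tendsto (fun t => along F h t x) atTop (𝓝 (mono a)) :=
      tendsto_const_nhds.congr' (by
        filter_upwards [eventually_ge_atTop T] with t ht
        exact (hz _ t ht).symm)
    refine ⟨fun hy => ?_, fun hy => hy ▸ ht.mapClusterPt⟩
    by_contra hne
    obtain ⟨U, V, hU, hV, hyU, haV, hUV⟩ := t2_separation hne
    obtain ⟨t, ht1, ht2⟩ := ((mapClusterPt_iff_frequently.1 hy U
      (hU.mem_nhds hyU)).and_eventually (ht (hV.mem_nhds haV))).exists
    exact Set.disjoint_left.1 hUV ht1 ht2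
  refine ⟨a, fun h _ => ?_⟩
  apply Set.Subset.antisymm
  · refine genericLimitSet_subset isClosed_singleton (univ_mem' fun x => ?_)
    exact (hlim h x).subset
  · rintro _ rfl V ⟨-, hVr⟩
    obtain ⟨x, hx⟩ := nonempty_of_mem_residual hVr
    exact hx ((hlim h x).superset rfl)

/-! ### Existence of the class -/

theorem min_mem_curves (hh : h ∈ curves) (hh' : h' ∈ curves) :
    (fun t => min (h t) (h' t)) ∈ curves := by
  obtain ⟨M, hM⟩ := exists_variation hh
  obtain ⟨M', hM'⟩ := exists_variation hh'
  refine ⟨M + M', fun t => abs_le.2 ?_⟩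
  have := hM t
  have := hM' t
  dsimp only
  constructor <;> omega

theorem max_mem_curves (hh : h ∈ curves) (hh' : h' ∈ curves) :
    (fun t => max (h t) (h' t)) ∈ curves := by
  obtain ⟨M, hM⟩ := exists_variation hh
  obtain ⟨M', hM'⟩ := exists_variation hh'
  refine ⟨M + M', fun t => abs_le.2 ?_⟩
  have := hM t
  have := hM' t
  dsimp only
  constructor <;> omega

theorem exists_curve_not_sameDir (hh : h ∈ curves) : ∃ h' ∈ curves, ¬ SameDir h' h := by
  obtain ⟨M, hM⟩ := exists_variation hh
  refine ⟨fun t => h t + t, ⟨M + 1, fun t => abs_le.2 ?_⟩, fun hs => ?_⟩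
  · have := hM t
    push_cast
    constructor <;> omega
  · obtain ⟨C, hC⟩ := hs.exists_bound
    have := hC (C + 1)
    push_cast at this
    omega

theorem SameDir.symm (hs : SameDir h h') : SameDir h' h := ⟨hs.2, hs.1⟩

/-- The case of two distinct directions of almost equicontinuity. -/
theorem IsBlock.class3 [Finite A] [Nonempty A] {M K n : ℕ} {u : Config A}
    (hb : IsBlock F r h M K u n) (hnil : ¬ Nilpotent (iterates F)) (hh : h ∈ curves)
    (hh' : h' ∈ curves) (hae' : AlmostEquicontinuous (along F h')) (hne : ¬ SameDir h' h) :
    Class3 F := by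
  have hF := hb.radius
  obtain ⟨⟨C, hC⟩, D, hD⟩ := (hb.almostEquicontinuous_iff hnil hh').1 hae'
  have hl := hb.leftEnd_le_self hnil
  have hr := hb.self_le_rightEnd hnil
  have hwide : ∀ L : ℤ, ∃ t, leftEnd F h u n t + L ≤ rightEnd F h u n t := by
    by_contra! hcon
    obtain ⟨L, hL⟩ := hcon
    refine hne ⟨⟨D + L.natAbs, fun t => ?_⟩, C + L.natAbs, fun t => ?_⟩ <;>
    · have := hL t
      have := hC t
      have := hD t
      have := hl t
      have := hr t
      omega
  obtain ⟨a, p, hp, hpa, hasym⟩ := hb.exists_asymptotic_mono hnil hwide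
  have hsens : ∀ g ∈ curves, ¬ (Preceq (leftEnd F h u n) g ∧ Preceq g (rightEnd F h u n)) →
      Sensitive (along F g) := fun g hg hgS => by
    by_contra hs
    exact hgS ((hb.almostEquicontinuous_iff hnil hg).1
      (hF.almostEquicontinuous_of_not_sensitive hg hs))
  have hgen : ∀ g ∈ curves, AlmostEquicontinuous (along F g) →
      genericLimitSet (along F g) = orbit (iterates F) (mono a) := fun g _ hae =>
    hF.genericLimitSet_eq_orbit_mono hp hpa hae (hasym g)
  refine ⟨{g ∈ curves | Preceq (leftEnd F h u n) g ∧ Preceq g (rightEnd F h u n)},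
    leftEnd F h u n, rightEnd F h u n, ⟨⟨0, fun t => ?_⟩, Or.inl rfl⟩, ?_, ?_, ?_, ?_,
    ⟨a, ?_, ?_⟩, ?_, ?_⟩
  · have := hl t
    have := hr t
    omega
  · refine ⟨_, ⟨min_mem_curves hh hh', ⟨C, fun t => ?_⟩, 0, fun t => ?_⟩,
      _, ⟨max_mem_curves hh hh', ⟨0, fun t => ?_⟩, D, fun t => ?_⟩,
      ⟨0, fun t => ?_⟩, fun ⟨E, hE⟩ => hne ⟨⟨E, fun t => ?_⟩, E, fun t => ?_⟩⟩
    iterate 5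
      have := hC t
      have := hD t
      have := hl t
      have := hr t
      dsimp only
      omega
    all_goals
      have hE' := hE t
      dsimp only at hE'
      omega
  · rintro g ⟨hg, hgS⟩
    obtain ⟨M', K', u', n', hb'⟩ := hF.exists_isBlock hg
      ((hb.almostEquicontinuous_iff hnil hg).2 hgS).not_sensitive
    exact hb'.mem_nonObliqueCurves hnil hg
  · rintro g ⟨hg, hgS⟩
    exact ⟨(hb.almostEquicontinuous_iff hnil hg).2 hgS,
      fun he => hnil (hF.nilpotent_of_isEquicontinuous he (hasym g))⟩
  · exact fun g hg hgS => hsens g hg fun hcon => hgS ⟨hg, hcon⟩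
  · rintro g ⟨hg, hgS⟩
    exact hgen g hg ((hb.almostEquicontinuous_iff hnil hg).2 hgS)
  · rintro g ⟨hg, hgS⟩
    rw [hgen g hg ((hb.almostEquicontinuous_iff hnil hg).2 hgS)]
    refine ⟨hasym g, ?_, hF.realm_orbit_mono hg hp hpa⟩
    refine hF.asymptoticClass_subset_realm g (hF.finite_orbit_mono a) fun t => ?_
    rw [hF.orbit_mono]
    exact ⟨t, rfl⟩
  · exact fun g hg hgS => hF.infinite_of_sensitive hg (hsens g hg fun hcon => hgS ⟨hg, hcon⟩)
  · exact fun g _ h1 h2 => hb.exists_dense_open hnil h1 h2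

theorem HasRadius.exists_class [Finite A] [Nonempty A] (hF : HasRadius F r) :
    Class1 F ∨ Class2 F ∨ Class3 F ∨ Class4 F ∨ Class4' F ∨ Class5 F := by
  by_cases hnil : Nilpotent (iterates F)
  · exact Or.inl (hF.class1_of_nilpotent hnil)
  by_cases hS : ∀ h ∈ curves, Sensitive (along F h)
  · exact Or.inr (Or.inr (Or.inr (Or.inr (Or.inr fun h hh =>
      ⟨hS h hh, hF.infinite_of_sensitive hh (hS h hh)⟩))))
  push Not at hS
  obtain ⟨h, hh, hs⟩ := hS
  obtain ⟨M, K, u, n, hb⟩ := hF.exists_isBlock hh hs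
  by_cases hne : ∃ h' ∈ curves, AlmostEquicontinuous (along F h') ∧ ¬ SameDir h' h
  · obtain ⟨h', hh', hae', hne⟩ := hne
    exact Or.inr (Or.inr (Or.inl (hb.class3 hnil hh hh' hae' hne)))
  push Not at hne
  have hob := hb.mem_nonObliqueCurves hnil hh
  have hsens : ∀ g ∈ curves, ¬ SameDir g h → Sensitive (along F g) := fun g hg hgh => by
    by_contra hs
    exact hgh (hne g hg (hF.almostEquicontinuous_of_not_sensitive hg hs))
  have hae : ∀ g ∈ curves, SameDir g h → AlmostEquicontinuous (along F g) := fun g hg hgh => by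
    obtain ⟨C, hC⟩ := hgh.exists_bound
    refine (hb.almostEquicontinuous_iff hnil hg).2 ⟨⟨C, fun t => ?_⟩, C, fun t => ?_⟩
    · have := hC t
      have := hb.leftEnd_le_self hnil t
      omega
    · have := hC t
      have := hb.self_le_rightEnd hnil t
      omega
  by_cases he : IsEquicontinuous (along F h)
  · refine Or.inr (Or.inl ⟨⟨h, hob, fun g hg => ⟨fun hgh => hF.isEquicontinuous_of_sameDir hgh he,
      hsens g hg⟩⟩, fun g _ => hF.genericLimitSet_eq_limitSet he g, ?_⟩)
    obtain ⟨g, hg, hgh⟩ := exists_curve_not_sameDir hh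
    rw [← hF.genericLimitSet_eq_limitSet he g]
    exact hF.infinite_of_sensitive hg (hsens g hg hgh)
  have hsingle : SingleStrictDirection F h := fun g hg =>
    ⟨fun hgh => ⟨hae g hg hgh, fun heg => he (hF.isEquicontinuous_of_sameDir hgh.symm heg)⟩,
      hsens g hg⟩
  by_cases hfin : (genericLimitSet (along F h)).Finite
  · refine Or.inr (Or.inr (Or.inr (Or.inr (Or.inl ⟨h, hob, hsingle, fun g hg =>
      ⟨fun hgfin => ?_, fun hgh => hF.finite_of_sameDir hgh hfin⟩⟩))))
    by_contra hgh
    exact hF.infinite_of_sensitive hg (hsens g hg hgh) hgfin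
  · refine Or.inr (Or.inr (Or.inr (Or.inl ⟨⟨h, hob, hsingle⟩, fun g hg => ?_⟩)))
    by_cases hgh : SameDir g h
    · exact fun hgfin => hfin (hF.finite_of_sameDir hgh.symm hgfin)
    · exact hF.infinite_of_sensitive hg (hsens g hg hgh)

/-! ### Uniqueness of the class -/

theorem SameDir.refl (h : ℕ → ℤ) : SameDir h h := ⟨⟨0, by simp⟩, 0, by simp⟩

theorem SameDir.trans {h'' : ℕ → ℤ} (h1 : SameDir h h') (h2 : SameDir h' h'') : SameDir h h'' := by
  obtain ⟨C, hC⟩ := h1.exists_bound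
  obtain ⟨D, hD⟩ := h2.exists_bound
  refine ⟨⟨C + D, fun t => ?_⟩, C + D, fun t => ?_⟩ <;>
  · have := hC t
    have := hD t
    omega

theorem Class1.finite (h1 : Class1 F) (hh : h ∈ curves) :
    (genericLimitSet (along F h)).Finite := by
  obtain ⟨-, a, ha⟩ := h1
  rw [ha h hh]
  exact Set.finite_singleton _

theorem Class1.not_strict (hF : HasRadius F r) (h1 : Class1 F) (h : ℕ → ℤ) :
    ¬ StrictlyAlmostEquicontinuous (along F h) :=
  fun hs => hs.2 (hF.nilpotent_isEquicontinuous h1.1 h)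

theorem Class2.not_strict [Finite A] [Nonempty A] (h2 : Class2 F) (hh : h ∈ curves) :
    ¬ StrictlyAlmostEquicontinuous (along F h) := by
  rintro ⟨hae, hne⟩
  obtain ⟨⟨h', -, hc⟩, -⟩ := h2
  by_cases hs : SameDir h h'
  · exact hne ((hc h hh).1 hs)
  · exact hae.not_sensitive ((hc h hh).2 hs)

theorem Class2.infinite (h2 : Class2 F) (hh : h ∈ curves) :
    (genericLimitSet (along F h)).Infinite := by
  rw [h2.2.1 h hh]
  exact h2.2.2

theorem Class2.exists_not_sensitive [Nonempty A] (h2 : Class2 F) :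
    ∃ h ∈ curves, ¬ Sensitive (along F h) := by
  obtain ⟨⟨h, hh, hc⟩, -⟩ := h2
  have he := (hc h hh.1).1 (SameDir.refl h)
  refine ⟨h, hh.1, not_sensitive_of_mem_equicontinuousPoints
    (x := mono (Classical.arbitrary A)) ?_⟩
  rw [he]
  trivial

theorem SingleStrictDirection.sameDir [Finite A] [Nonempty A]
    (hs : SingleStrictDirection F h') (hh : h ∈ curves)
    (hst : StrictlyAlmostEquicontinuous (along F h)) : SameDir h h' := by
  by_contra hne
  exact hst.1.not_sensitive ((hs h hh).2 hne)

theorem Class3.exists_strict (h3 : Class3 F) :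
    ∃ h₁ ∈ curves, ∃ h₂ ∈ curves, ¬ SameDir h₁ h₂ ∧
      StrictlyAlmostEquicontinuous (along F h₁) ∧ StrictlyAlmostEquicontinuous (along F h₂) := by
  obtain ⟨S, lo, hi, -, ⟨h₁, hm₁, h₂, hm₂, hlt⟩, hsub, hst, -⟩ := h3
  exact ⟨h₁, (hsub hm₁).1, h₂, (hsub hm₂).1, fun hs => hlt.2 hs.2, hst h₁ hm₁, hst h₂ hm₂⟩

theorem Class3.not_single [Finite A] [Nonempty A] (h3 : Class3 F) : ¬ SingleStrictDirection F h' := by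
  intro hs
  obtain ⟨h₁, hh₁, h₂, hh₂, hne, hst₁, hst₂⟩ := h3.exists_strict
  exact hne ((hs.sameDir hh₁ hst₁).trans (hs.sameDir hh₂ hst₂).symm)

theorem Class4.exists_strict (h4 : Class4 F) :
    ∃ h ∈ curves, StrictlyAlmostEquicontinuous (along F h) := by
  obtain ⟨⟨h, hh, hs⟩, -⟩ := h4
  exact ⟨h, hh.1, (hs h hh.1).1 (SameDir.refl h)⟩

theorem Class4'.exists_strict (h4 : Class4' F) :
    ∃ h ∈ curves, StrictlyAlmostEquicontinuous (along F h) := by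
  obtain ⟨h, hh, hs, -⟩ := h4
  exact ⟨h, hh.1, (hs h hh.1).1 (SameDir.refl h)⟩

theorem Class5.not_strict [Finite A] [Nonempty A] (h5 : Class5 F) (hh : h ∈ curves) :
    ¬ StrictlyAlmostEquicontinuous (along F h) :=
  fun hst => hst.1.not_sensitive (h5 h hh).1

theorem zero_mem_curves : (fun _ => 0 : ℕ → ℤ) ∈ curves := ⟨0, by simp⟩

/-- The six classes, in the order of the classification. -/
def classes (F : Config A → Config A) : Fin 6 → Prop :=
  ![Class1 F, Class2 F, Class3 F, Class4 F, Class4' F, Class5 F]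

theorem HasRadius.not_classes_of_lt [Finite A] [Nonempty A] (hF : HasRadius F r)
    {i j : Fin 6} (hij : i < j) (hi : classes F i) (hj : classes F j) : False := by
  have h3 : Class3 F → ∃ h ∈ curves, StrictlyAlmostEquicontinuous (along F h) := fun h3 => by
    obtain ⟨h, hh, -, -, -, hst, -⟩ := h3.exists_strict
    exact ⟨h, hh, hst⟩
  have h345 : Class3 F ∨ Class4 F ∨ Class4' F →
      ∃ h ∈ curves, StrictlyAlmostEquicontinuous (along F h) := by
    rintro (h | h | h)
    exacts [h3 h, h.exists_strict, h.exists_strict]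
  have e1 : Class1 F → ¬ (Class3 F ∨ Class4 F ∨ Class4' F) := fun h1 h => by
    obtain ⟨g, -, hst⟩ := h345 h
    exact h1.not_strict hF g hst
  have e2 : Class2 F → ¬ (Class3 F ∨ Class4 F ∨ Class4' F) := fun h2 h => by
    obtain ⟨g, hg, hst⟩ := h345 h
    exact h2.not_strict hg hst
  have e5 : Class5 F → ¬ (Class3 F ∨ Class4 F ∨ Class4' F) := fun h5 h => by
    obtain ⟨g, hg, hst⟩ := h345 h
    exact h5.not_strict hg hst
  have e12 : Class1 F → ¬ Class2 F := fun h1 h2 =>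
    h2.infinite zero_mem_curves (h1.finite zero_mem_curves)
  have e15 : Class1 F → ¬ Class5 F := fun h1 h5 =>
    (h5 _ zero_mem_curves).2 (h1.finite zero_mem_curves)
  have e25 : Class2 F → ¬ Class5 F := fun h2 h5 => by
    obtain ⟨h, hh, hs⟩ := h2.exists_not_sensitive
    exact hs (h5 h hh).1
  have e34 : Class3 F → ¬ Class4 F := fun h3 ⟨⟨_, _, hs⟩, _⟩ => h3.not_single hs
  have e34' : Class3 F → ¬ Class4' F := fun h3 ⟨_, _, hs, _⟩ => h3.not_single hs
  have e44' : Class4 F → ¬ Class4' F := fun h4 ⟨h', hh', _, hf⟩ =>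
    h4.2 h' hh'.1 ((hf h' hh'.1).2 (SameDir.refl h'))
  unfold classes at hi hj
  clear h3 h345 hF
  generalize Class1 F = C₁ at *
  generalize Class2 F = C₂ at *
  generalize Class3 F = C₃ at *
  generalize Class4 F = C₄ at *
  generalize Class4' F = C₄' at *
  generalize Class5 F = C₅ at *
  fin_cases i <;> fin_cases j <;> first
    | exact absurd hij (by decide)
    | exact e12 hi hj
    | exact e15 hi hj
    | exact e25 hi hj
    | exact e34 hi hj
    | exact e34' hi hj
    | exact e44' hi hj
    | exact e1 hi (Or.inl hj)
    | exact e1 hi (Or.inr (Or.inl hj))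
    | exact e1 hi (Or.inr (Or.inr hj))
    | exact e2 hi (Or.inl hj)
    | exact e2 hi (Or.inr (Or.inl hj))
    | exact e2 hi (Or.inr (Or.inr hj))
    | exact e5 hj (Or.inl hi)
    | exact e5 hj (Or.inr (Or.inl hi))
    | exact e5 hj (Or.inr (Or.inr hi))

end GenericLimit

theorem theoremt {A : Type*} [Finite A] [Nonempty A]
    (F : GenericLimit.Config A → GenericLimit.Config A) (hF : GenericLimit.IsCA F) :
    ∃! k : Fin 6,
      (![GenericLimit.Class1 F, GenericLimit.Class2 F, GenericLimit.Class3 F,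
        GenericLimit.Class4 F, GenericLimit.Class4' F, GenericLimit.Class5 F] : Fin 6 → Prop) k := by
  obtain ⟨r, hr⟩ := hF.exists_hasRadius
  have hex : ∃ k, GenericLimit.classes F k := by
    rcases hr.exists_class with h | h | h | h | h | h
    exacts [⟨0, h⟩, ⟨1, h⟩, ⟨2, h⟩, ⟨3, h⟩, ⟨4, h⟩, ⟨5, h⟩]
  obtain ⟨k, hk⟩ := hex
  refine ⟨k, hk, fun l hl => ?_⟩
  by_contra hne
  rcases lt_or_gt_of_ne hne with hlt | hlt
  · exact hr.not_classes_of_lt hlt hl hk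
  · exact hr.not_classes_of_lt hlt hk hl
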